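/- Let $\Bbbk$ be an algebraically closed field of characteristic zero, $H$ a semisimple Hopf algebra over $\Bbbk$ with antipode $S$ (a Hopf algebra whose underlying algebra is semisimple), and $K$ a semisimple $\Bbbk$-algebra. Let $p = p^1\otimes p^2 \in K\otimes K$ (summation suppressed) be a symmetric separability idempotent for $K$, i.e. \[ xp^1\otimes p^2 = p^1\otimes p^2x \ \ (x\in K), \qquad p^1p^2 = 1, \qquad p^1\otimes p^2 = p^2\otimes p^1 , \] regarded as an element of $K\otimes K^{\mathrm{op}}$. (Right case.) Suppose $K$ is a right $H$-comodule algebra, i.e. it is equipped with a coassociative and counital coaction $K\to K\otimes H$, $k\mapsto k_{(0)}\otimes k_{(1)}$, that is a morphism of algebras. Then $p$ is $H$-coinvariant for the coaction $K\otimes K^{\mathrm{op}}\to K\otimes K^{\mathrm{op}}\otimes H$, $k\otimes k'\mapsto k_{(0)}\otimes k'_{(0)}\otimes k_{(1)}k'_{(1)}$, i.e. \[ p^1_{(0)}\otimes p^2_{(0)}\otimes p^1_{(1)}p^2_{(1)} = p^1\otimes p^2\otimes 1_H , \] and \[ p^1_{(0)}\otimes p^1_{(1)}\otimes p^2 = p^1\otimes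 S(p^2_{(1)})\otimes p^2_{(0)} \quad\text{in } K\otimes H\otimes K^{\mathrm{op}} . \] Moreover these two conditions are equivalent, for every element $p^1\otimes p^2$ of $K\otimes K^{\mathrm{op}}$. (Left case.) Suppose $K$ is a left $H$-comodule algebra, with coaction $K\to H\otimes K$, $k\mapsto k_{(-1)}\otimes k_{(0)}$, coassociative, counital and a morphism of algebras. Then $p$ is $H$-coinvariant for the coaction $K\otimes K^{\mathrm{op}}\to H\otimes K\otimes K^{\mathrm{op}}$, $k\otimes k'\mapsto k_{(-1)}k'_{(-1)}\otimes k_{(0)}\otimes k'_{(0)}$, i.e. \[ p^1_{(-1)}p^2_{(-1)}\otimes p^1_{(0)}\otimes p^2_{(0)} = 1_H\otimes p^1\otimes p^2 , \] and \[ p^1_{(0)}\otimes p^1_{(-1)}\otimes p^2 = p^1\otimes S(p^2_{(-1)})\otimes p^2_{(0)} \quad\text{in } K\otimes H\otimes K^{\mathrm{op}} . \] Moreover these two conditions are equivalent, for every element $p^1\otimes p^2$ of $K\otimes K^{\mathrm{op}}$. -/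

import Mathlib

open scoped TensorProduct

noncomputable section

/-- A right `H`-comodule algebra structure on the `k`-algebra `K`: a coassociative and counital
right coaction `K → K ⊗ H`, `a ↦ a₍₀₎ ⊗ a₍₁₎`, which is a morphism of algebras. -/
structure RightComoduleAlgebra (k H K : Type*) [Field k] [Ring H] [Bialgebra k H]
    [Ring K] [Algebra k K] where
  /-- The coaction. -/
  coact : K →ₐ[k] K ⊗[k] H
  coassoc : (TensorProduct.assoc k K H H).toLinearMap ∘ₗ
      LinearMap.rTensor H coact.toLinearMap ∘ₗ coact.toLinearMap =
    LinearMap.lTensor K (Coalgebra.comul (R := k) (A := H)) ∘ₗ coact.toLinearMap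
  counit_coact : (TensorProduct.rid k K).toLinearMap ∘ₗ
      LinearMap.lTensor K (Coalgebra.counit (R := k) (A := H)) ∘ₗ coact.toLinearMap =
    LinearMap.id

/-- A left `H`-comodule algebra structure on the `k`-algebra `K`: a coassociative and counital
left coaction `K → H ⊗ K`, `a ↦ a₍₋₁₎ ⊗ a₍₀₎`, which is a morphism of algebras. -/
structure LeftComoduleAlgebra (k H K : Type*) [Field k] [Ring H] [Bialgebra k H]
    [Ring K] [Algebra k K] where
  /-- The coaction. -/
  coact : K →ₐ[k] H ⊗[k] K
  coassoc : LinearMap.lTensor H coact.toLinearMap ∘ₗ coact.toLinearMap =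
    (TensorProduct.assoc k H H K).toLinearMap ∘ₗ
      LinearMap.rTensor K (Coalgebra.comul (R := k) (A := H)) ∘ₗ coact.toLinearMap
  counit_coact : (TensorProduct.lid k K).toLinearMap ∘ₗ
      LinearMap.rTensor K (Coalgebra.counit (R := k) (A := H)) ∘ₗ coact.toLinearMap =
    LinearMap.id

/-- `p = p¹ ⊗ p² ∈ A ⊗ A` is a symmetric separability idempotent for the `k`-algebra `A`. -/
structure IsSymmSepIdempotent (k : Type*) {A : Type*} [Field k] [Ring A] [Algebra k A]
    (p : A ⊗[k] A) : Prop where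
  /-- `(x · p¹) ⊗ p² = p¹ ⊗ (p² · x)` for all `x`. -/
  invariant : ∀ x : A,
    LinearMap.rTensor A (LinearMap.mulLeft k x) p = LinearMap.lTensor A (LinearMap.mulRight k x) p
  /-- `p¹ · p² = 1`. -/
  normalized : LinearMap.mul' k A p = 1
  /-- `p¹ ⊗ p² = p² ⊗ p¹`. -/
  symmetric : TensorProduct.comm k A A p = p

/-! The opposite algebra of `K` has the same underlying vector space as `K`. The coactions and
conditions below only involve the vector space underlying `K ⊗ Kᵒᵖ`, which is `K ⊗[k] K`. -/

namespace RightComoduleAlgebra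

variable {k H K : Type*} [Field k] [Ring H] [HopfAlgebra k H] [Ring K] [Algebra k K]
  (ρ : RightComoduleAlgebra k H K)

/-- The right `H`-coaction `a ⊗ b ↦ a₍₀₎ ⊗ b₍₀₎ ⊗ a₍₁₎ b₍₁₎` on `K ⊗ Kᵒᵖ`. -/
def envCoact : K ⊗[k] K →ₗ[k] (K ⊗[k] K) ⊗[k] H :=
  LinearMap.lTensor (K ⊗[k] K) (LinearMap.mul' k H) ∘ₗ
    (TensorProduct.tensorTensorTensorComm k K H K H).toLinearMap ∘ₗ
      TensorProduct.map ρ.coact.toLinearMap ρ.coact.toLinearMap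

/-- `x` is coinvariant: `x¹₍₀₎ ⊗ x²₍₀₎ ⊗ x¹₍₁₎ x²₍₁₎ = x¹ ⊗ x² ⊗ 1`. -/
def IsCoinvariant (x : K ⊗[k] K) : Prop :=
  ρ.envCoact x = x ⊗ₜ[k] (1 : H)

/-- `x¹₍₀₎ ⊗ x¹₍₁₎ ⊗ x² = x¹ ⊗ S(x²₍₁₎) ⊗ x²₍₀₎` in `K ⊗ H ⊗ Kᵒᵖ`. -/
def IsCyclic (x : K ⊗[k] K) : Prop :=
  TensorProduct.assoc k K H K (LinearMap.rTensor K ρ.coact.toLinearMap x) =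
    LinearMap.lTensor K
      (LinearMap.rTensor K (HopfAlgebra.antipode k (A := H)) ∘ₗ
        (TensorProduct.comm k K H).toLinearMap ∘ₗ ρ.coact.toLinearMap) x

end RightComoduleAlgebra

namespace LeftComoduleAlgebra

variable {k H K : Type*} [Field k] [Ring H] [HopfAlgebra k H] [Ring K] [Algebra k K]
  (ρ : LeftComoduleAlgebra k H K)

/-- The left `H`-coaction `a ⊗ b ↦ a₍₋₁₎ b₍₋₁₎ ⊗ a₍₀₎ ⊗ b₍₀₎` on `K ⊗ Kᵒᵖ`. -/
def envCoact : K ⊗[k] K →ₗ[k] H ⊗[k] (K ⊗[k] K) :=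
  LinearMap.rTensor (K ⊗[k] K) (LinearMap.mul' k H) ∘ₗ
    (TensorProduct.tensorTensorTensorComm k H K H K).toLinearMap ∘ₗ
      TensorProduct.map ρ.coact.toLinearMap ρ.coact.toLinearMap

/-- `x` is coinvariant: `x¹₍₋₁₎ x²₍₋₁₎ ⊗ x¹₍₀₎ ⊗ x²₍₀₎ = 1 ⊗ x¹ ⊗ x²`. -/
def IsCoinvariant (x : K ⊗[k] K) : Prop :=
  ρ.envCoact x = (1 : H) ⊗ₜ[k] x

/-- `x¹₍₀₎ ⊗ x¹₍₋₁₎ ⊗ x² = x¹ ⊗ S(x²₍₋₁₎) ⊗ x²₍₀₎` in `K ⊗ H ⊗ Kᵒᵖ`. -/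
def IsCyclic (x : K ⊗[k] K) : Prop :=
  TensorProduct.assoc k K H K
      (LinearMap.rTensor K
        ((TensorProduct.comm k H K).toLinearMap ∘ₗ ρ.coact.toLinearMap) x) =
    LinearMap.lTensor K
      (LinearMap.rTensor K (HopfAlgebra.antipode k (A := H)) ∘ₗ ρ.coact.toLinearMap) x

end LeftComoduleAlgebra

end

/-! Choose a basis of `K`, write ρ(bⱼ) = ∑ bᵢ ⊗ Rᵢⱼ (factors exchanged for a left coaction), and let
P be the coefficient matrix of an element of `K ⊗ K`. On either side, coinvariance reads R P Rᵀ = P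
and the cyclic condition reads R P = P S(R)ᵀ, so they are equivalent once S(R)ᵀ is a two-sided
inverse of Rᵀ. The entries do not commute: for a right coaction the antipode axioms only give R S(R)
= S(R) R = 1, and the transposed identities follow on applying S when S² = 1. For a left coaction
the two kinds of identity swap roles.

For the idempotent itself, P is the inverse of the Gram matrix G of the regular trace form
(`IsSymmSepIdempotent.exists_trace`). That trace is invariant under the coaction
(`contractFst_coact_trace`), so Rᵀ G R = G, and inverting gives R P Rᵀ = P.

What remains is the Larson–Radford theorem S² = 1 (`antipode_antipode`). Semisimplicity gives an
integral Λ with ε(Λ) = 1, and nondegeneracy of Δ(Λ) gives a dual integral λ. Then y ↦ S⁻²(y)x has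
trace λ(S(x)), and S⁴(a)g = ga for a group-like g of finite order, so S² has finite order. If λ(1) =
0, then S⁻² has trace zero; on a semisimple algebra this trace is a sum of terms |tr T|², so all of
them vanish and so does the trace of every y ↦ S⁻²(y)x, contradicting λ(S(Λ)) = 1. Hence λ(1) ≠ 0,
which forces g = 1 and S⁴ = 1. An integrality count with the idempotent (dim H)⁻¹ · (regular
character) then shows that S² has no eigenvalue −1. -/

noncomputable section

namespace HopfAlgebra

open Coalgebra WithConv LinearMap Algebra.TensorProduct

/-! ### Convolution identities for the antipode -/

section Convolution

variable {k H A : Type*} [CommSemiring k] [Semiring H] [HopfAlgebra k H] [Semiring A] [Algebra k A]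

lemma algHom_comp_antipode_convMul (f : H →ₐ[k] A) :
    toConv (f.toLinearMap ∘ₗ antipode k) * toConv f.toLinearMap = 1 := by
  have h := algHom_comp_convMul_distrib f (toConv (antipode k (A := H))) (toConv LinearMap.id)
  rw [antipode_mul_id] at h
  apply WithConv.ofConv_injective
  refine Eq.trans h.symm ?_
  ext; simp [LinearMap.convOne_def]

lemma algHom_convMul_comp_antipode (f : H →ₐ[k] A) :
    toConv f.toLinearMap * toConv (f.toLinearMap ∘ₗ antipode k) = 1 := by
  have h := algHom_comp_convMul_distrib f (toConv LinearMap.id) (toConv (antipode k (A := H)))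
  rw [id_mul_antipode] at h
  apply WithConv.ofConv_injective
  refine Eq.trans h.symm ?_
  ext; simp [LinearMap.convOne_def]

variable (k H) in
lemma toConv_comul_eq :
    toConv (comul (R := k) (A := H)) =
      toConv (includeLeft : H →ₐ[k] H ⊗[k] H).toLinearMap *
        toConv (includeRight : H →ₐ[k] H ⊗[k] H).toLinearMap := by
  ext x
  rw [(ℛ k x).convMul_apply]
  simp [(ℛ k x).eq]

/-- The antipode is an anti-morphism of coalgebras. -/
lemma comul_antipode (x : H) :
    comul (R := k) (antipode k x) =
      TensorProduct.map (antipode k) (antipode k) (TensorProduct.comm k H H (comul x)) := by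
  -- Both sides are convolution inverses of Δ: Δ ∘ S from the left, and, since Δ = i * j, the
  -- product j' * i' from the right.
  have h1 := algHom_comp_antipode_convMul (Bialgebra.comulAlgHom k H)
  set i := toConv (includeLeft : H →ₐ[k] H ⊗[k] H).toLinearMap
  set j := toConv (includeRight : H →ₐ[k] H ⊗[k] H).toLinearMap
  set i' := toConv ((includeLeft : H →ₐ[k] H ⊗[k] H).toLinearMap ∘ₗ antipode k)
  set j' := toConv ((includeRight : H →ₐ[k] H ⊗[k] H).toLinearMap ∘ₗ antipode k)
  have h2 : toConv (Bialgebra.comulAlgHom k H).toLinearMap * (j' * i') = 1 := by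
    have : toConv (Bialgebra.comulAlgHom k H).toLinearMap = i * j := toConv_comul_eq k H
    rw [this, mul_assoc, ← mul_assoc j, algHom_convMul_comp_antipode, one_mul,
      algHom_convMul_comp_antipode]
  have h3 := congr($(left_inv_eq_right_inv h1 h2) x)
  refine Eq.trans h3 ?_
  rw [(ℛ k x).convMul_apply]
  conv_rhs => rw [← (ℛ k x).eq]
  simp [i', j']

/-- `S(x₁)x₂ ⊗ x₃ = 1 ⊗ x`. -/
lemma sum_antipode_tmul_mul_comul (x : H) :
    ∑ i ∈ (ℛ k x).index, (antipode k ((ℛ k x).left i) ⊗ₜ[k] (1 : H)) * comul ((ℛ k x).right i) =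
      1 ⊗ₜ[k] x := by
  have h : toConv ((includeLeft : H →ₐ[k] H ⊗[k] H).toLinearMap ∘ₗ antipode k) *
      toConv (comul (R := k) (A := H)) = toConv includeRight.toLinearMap := by
    rw [toConv_comul_eq, ← mul_assoc, algHom_comp_antipode_convMul, one_mul]
  have h' := congr($h x)
  rw [(ℛ k x).convMul_apply] at h'
  simpa using h'

/-- `x₁ ⊗ x₂S(x₃) = x ⊗ 1`. -/
lemma sum_comul_mul_tmul_antipode (x : H) :
    ∑ i ∈ (ℛ k x).index, comul ((ℛ k x).left i) * ((1 : H) ⊗ₜ[k] antipode k ((ℛ k x).right i)) =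
      x ⊗ₜ[k] 1 := by
  have h : toConv (comul (R := k) (A := H)) *
      toConv ((includeRight : H →ₐ[k] H ⊗[k] H).toLinearMap ∘ₗ antipode k) =
        toConv includeLeft.toLinearMap := by
    rw [toConv_comul_eq, mul_assoc, algHom_convMul_comp_antipode, mul_one]
  have h' := congr($h x)
  rw [(ℛ k x).convMul_apply] at h'
  simpa using h'

end Convolution

end HopfAlgebra

end

/-! ### Contractions of tensors and nondegeneracy -/

noncomputable section

open Module

section Contraction

variable {k : Type*} [Field k] {M N P : Type*} [AddCommGroup M] [Module k M] [AddCommGroup N]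
  [Module k N] [AddCommGroup P] [Module k P]

/-- The map `f ↦ f(T¹) T²` attached to a tensor `T = T¹ ⊗ T²`. -/
def contractFst (T : M ⊗[k] N) : Dual k M →ₗ[k] N where
  toFun f := TensorProduct.lid k N (f.rTensor N T)
  map_add' f g := by simp [LinearMap.rTensor_add]
  map_smul' c f := by simp [LinearMap.rTensor_smul]

lemma contractFst_def (T : M ⊗[k] N) (f : Dual k M) :
    contractFst T f = TensorProduct.lid k N (f.rTensor N T) := rfl

@[simp]
lemma contractFst_tmul (m : M) (n : N) (f : Dual k M) : contractFst (m ⊗ₜ[k] n) f = f m • n := by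
  simp [contractFst_def]

@[simp]
lemma contractFst_add (T U : M ⊗[k] N) (f : Dual k M) :
    contractFst (T + U) f = contractFst T f + contractFst U f := by
  simp [contractFst_def]

@[simp]
lemma contractFst_zero (f : Dual k M) : contractFst (0 : M ⊗[k] N) f = 0 := by
  simp [contractFst_def]

@[simp]
lemma contractFst_smul (c : k) (T : M ⊗[k] N) (f : Dual k M) :
    contractFst (c • T) f = c • contractFst T f := by
  simp [contractFst_def]

lemma contractFst_sum {ι : Type*} (s : Finset ι) (T : ι → M ⊗[k] N) (f : Dual k M) :
    contractFst (∑ i ∈ s, T i) f = ∑ i ∈ s, contractFst (T i) f := by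
  simp [contractFst_def, map_sum]

lemma contractFst_rTensor (β : P →ₗ[k] M) (T : P ⊗[k] N) (f : Dual k M) :
    contractFst (β.rTensor N T) f = contractFst T (f ∘ₗ β) := by
  simp [contractFst_def, LinearMap.rTensor_comp_apply]

lemma contractFst_lTensor (β : N →ₗ[k] P) (T : M ⊗[k] N) (f : Dual k M) :
    contractFst (β.lTensor M T) f = β (contractFst T f) := by
  induction T with
  | zero => simp
  | tmul m n => simp
  | add x y hx hy => simp [hx, hy]

lemma contractFst_sum_basis_coord {ι : Type*} (b : Basis ι k M) (c : ι →₀ N) (i : ι) :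
    contractFst (c.sum fun i n => b i ⊗ₜ[k] n) (b.coord i) = c i := by
  classical
  rw [Finsupp.sum, contractFst_sum]
  simp [Finsupp.single_apply, ite_smul, eq_comm]

/-- A tensor is determined by its contractions. -/
lemma contractFst_ext {T U : M ⊗[k] N} (h : ∀ f, contractFst T f = contractFst U f) : T = U := by
  let b := Basis.ofVectorSpace k M
  obtain ⟨c, hc⟩ := TensorProduct.eq_repr_basis_left b T
  obtain ⟨d, hd⟩ := TensorProduct.eq_repr_basis_left b U
  have hcd : c = d := by
    ext i
    rw [← contractFst_sum_basis_coord b c i, hc, h, ← hd, contractFst_sum_basis_coord]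
  rw [← hc, ← hd, hcd]

/-- The map `f ↦ T¹ f(T²)` attached to a tensor `T = T¹ ⊗ T²`. -/
def contractSnd (T : M ⊗[k] N) : Dual k N →ₗ[k] M where
  toFun f := TensorProduct.rid k M (f.lTensor M T)
  map_add' f g := by simp [LinearMap.lTensor_add]
  map_smul' c f := by simp [LinearMap.lTensor_smul]

lemma contractSnd_def (T : M ⊗[k] N) (f : Dual k N) :
    contractSnd T f = TensorProduct.rid k M (f.lTensor M T) := rfl

@[simp]
lemma contractSnd_tmul (m : M) (n : N) (f : Dual k N) : contractSnd (m ⊗ₜ[k] n) f = f n • m := by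
  simp [contractSnd_def]

@[simp]
lemma contractSnd_add (T U : M ⊗[k] N) (f : Dual k N) :
    contractSnd (T + U) f = contractSnd T f + contractSnd U f := by
  simp [contractSnd_def]

@[simp]
lemma contractSnd_zero (f : Dual k N) : contractSnd (0 : M ⊗[k] N) f = 0 := by
  simp [contractSnd_def]

lemma contractSnd_rTensor (β : M →ₗ[k] P) (T : M ⊗[k] N) (f : Dual k N) :
    contractSnd (β.rTensor N T) f = β (contractSnd T f) := by
  induction T with
  | zero => simp
  | tmul m n => simp
  | add x y hx hy => simp [hx, hy]

lemma contractSnd_lTensor (β : P →ₗ[k] N) (T : M ⊗[k] P) (f : Dual k N) :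
    contractSnd (β.lTensor M T) f = contractSnd T (f ∘ₗ β) := by
  simp [contractSnd_def, LinearMap.lTensor_comp_apply]

lemma apply_contractFst (T : M ⊗[k] N) (f : Dual k M) (g : Dual k N) :
    g (contractFst T f) = f (contractSnd T g) := by
  induction T with
  | zero => simp
  | tmul m n => simp [mul_comm]
  | add x y hx hy => simp [hx, hy]

/-- The map `T ↦ f(T¹) T²`. -/
def sliceFst (N : Type*) [AddCommGroup N] [Module k N] (f : Dual k M) : M ⊗[k] N →ₗ[k] N :=
  (TensorProduct.lid k N).toLinearMap ∘ₗ f.rTensor N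

lemma sliceFst_apply (f : Dual k M) (T : M ⊗[k] N) : sliceFst N f T = contractFst T f := rfl

lemma contractFst_contractFst_assoc (T : (M ⊗[k] N) ⊗[k] P) (f : Dual k M) (g : Dual k N) :
    contractFst (contractFst (TensorProduct.assoc k M N P T) f) g =
      contractFst T (g ∘ₗ sliceFst N f) := by
  induction T with
  | zero => simp
  | tmul t p =>
    induction t with
    | zero => simp
    | tmul m n => simp [sliceFst_apply, mul_smul]
    | add x y hx hy =>
      simp only [TensorProduct.add_tmul, map_add, contractFst_add] at hx hy ⊢
      rw [hx, hy]
  | add x y hx hy => simp [hx, hy]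

/-- The trace of `v ↦ Ψ(v)(T¹) T²` is `Ψ(T²)(T¹)`. -/
lemma trace_contractFst [FiniteDimensional k N] (T : M ⊗[k] N) (Ψ : N →ₗ[k] Dual k M) :
    LinearMap.trace k N (contractFst T ∘ₗ Ψ) = TensorProduct.lift Ψ.flip T := by
  induction T with
  | zero =>
    rw [show contractFst (0 : M ⊗[k] N) ∘ₗ Ψ = 0 by ext; simp]
    simp
  | tmul m n =>
    rw [show contractFst (m ⊗ₜ[k] n) ∘ₗ Ψ = (Ψ.flip m).smulRight n by ext; simp]
    simp
  | add x y hx hy =>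
    rw [show contractFst (x + y) ∘ₗ Ψ = contractFst x ∘ₗ Ψ + contractFst y ∘ₗ Ψ by ext; simp,
      map_add, map_add, hx, hy]

variable {A : Type*} [Ring A] [Algebra k A]

/-- A tensor `T ∈ A ⊗ A` whose second legs span a left ideal containing `1` is nondegenerate, and
forces `A` to be finite dimensional. -/
theorem finite_and_bijective_contractFst (T : A ⊗[k] A)
    (hT : ∀ a : A, ∃ β : A →ₗ[k] A,
      (LinearMap.mulLeft k a).lTensor A T = β.rTensor A T)
    (s : A →ₗ[k] A) (hs : LinearMap.mul' k A (s.rTensor A T) = 1) :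
    FiniteDimensional k A ∧ Function.Bijective (contractFst T) := by
  let b := Basis.ofVectorSpace k A
  obtain ⟨c, hc⟩ := TensorProduct.eq_repr_basis_left b T
  have hci (i) : contractFst T (b.coord i) = c i := by rw [← hc, contractFst_sum_basis_coord]
  have hideal (a x : A) (hx : x ∈ LinearMap.range (contractFst T)) :
      a * x ∈ LinearMap.range (contractFst T) := by
    obtain ⟨f, rfl⟩ := hx
    obtain ⟨β, hβ⟩ := hT a
    refine ⟨f ∘ₗ β, ?_⟩
    rw [← contractFst_rTensor, ← hβ, contractFst_lTensor, LinearMap.mulLeft_apply]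
  -- The second legs `c i` lie in the range, which is a left ideal, and `hs` writes 1 as a left
  -- combination of them.
  have h1 : (1 : A) ∈ LinearMap.range (contractFst T) := by
    have h2 : (1 : A) = ∑ i ∈ c.support, s (b i) * c i := by
      rw [← hs]
      conv_lhs => rw [← hc, Finsupp.sum, map_sum, map_sum]
      simp
    rw [h2]
    refine Submodule.sum_mem _ fun i _ => ?_
    exact hideal _ _ ⟨_, hci i⟩
  have hsurj : Function.Surjective (contractFst T) := by
    intro x
    simpa using hideal x 1 h1
  -- The range is spanned by the finitely many second legs of `T`, yet it is all of `A`.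
  have hfd : FiniteDimensional k A := by
    classical
    refine ⟨⟨c.support.image c, eq_top_iff.2 fun x _ => ?_⟩⟩
    obtain ⟨f, rfl⟩ := hsurj x
    rw [← hc, Finsupp.sum, contractFst_sum]
    refine Submodule.sum_mem _ fun i hi => ?_
    rw [contractFst_tmul]
    exact Submodule.smul_mem _ _ (Submodule.subset_span
      (Finset.mem_coe.2 (Finset.mem_image_of_mem c hi)))
  refine ⟨hfd, ?_, hsurj⟩
  exact (LinearMap.injective_iff_surjective_of_finrank_eq_finrank
    (Subspace.dual_finrank_eq)).2 hsurj

end Contraction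

end

/-! ### Integrals of a semisimple Hopf algebra -/

noncomputable section

open Module

section MulTensor

variable {k A : Type*} [Field k] [Ring A] [Algebra k A]

lemma lTensor_mulLeft_eq (a : A) (T : A ⊗[k] A) :
    (LinearMap.mulLeft k a).lTensor A T = (1 ⊗ₜ[k] a) * T := by
  induction T with
  | zero => simp
  | tmul m n => simp
  | add x y hx hy => simp [hx, hy, mul_add]

lemma rTensor_mulLeft_eq (a : A) (T : A ⊗[k] A) :
    (LinearMap.mulLeft k a).rTensor A T = (a ⊗ₜ[k] 1) * T := by
  induction T with
  | zero => simp
  | tmul m n => simp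
  | add x y hx hy => simp [hx, hy, mul_add]

lemma lTensor_mulRight_eq (a : A) (T : A ⊗[k] A) :
    (LinearMap.mulRight k a).lTensor A T = T * (1 ⊗ₜ[k] a) := by
  induction T with
  | zero => simp
  | tmul m n => simp
  | add x y hx hy => simp [hx, hy, add_mul]

lemma rTensor_mulRight_eq (a : A) (T : A ⊗[k] A) :
    (LinearMap.mulRight k a).rTensor A T = T * (a ⊗ₜ[k] 1) := by
  induction T with
  | zero => simp
  | tmul m n => simp
  | add x y hx hy => simp [hx, hy, add_mul]

end MulTensor

namespace HopfAlgebra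

open Coalgebra

variable {k H : Type*} [Field k] [Ring H] [HopfAlgebra k H]

lemma sum_counit_smul_left (h : H) :
    ∑ i ∈ (ℛ k h).index, counit (R := k) ((ℛ k h).right i) • (ℛ k h).left i = h := by
  simpa only [map_sum, TensorProduct.rid_tmul, one_smul]
    using congr(TensorProduct.rid k H $(sum_tmul_counit_eq (R := k) (ℛ k h)))

/-- The map `x ↦ f(x₁) x₂`. -/
def leftHit (f : Dual k H) : H →ₗ[k] H := sliceFst H f ∘ₗ comul

/-- The map `x ↦ x₁ f(x₂)`. -/
def rightHit (f : Dual k H) : H →ₗ[k] H :=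
  (TensorProduct.rid k H).toLinearMap ∘ₗ f.lTensor H ∘ₗ comul

lemma leftHit_apply (f : Dual k H) (x : H) : leftHit f x = contractFst (comul (R := k) x) f := rfl

lemma rightHit_apply (f : Dual k H) (x : H) : rightHit f x = contractSnd (comul (R := k) x) f := rfl

lemma apply_leftHit (f g : Dual k H) (x : H) : g (leftHit f x) = f (rightHit g x) :=
  apply_contractFst _ _ _

lemma leftHit_leftHit (f g : Dual k H) (x : H) :
    leftHit g (leftHit f x) = leftHit (g ∘ₗ leftHit f) x := by
  rw [leftHit_apply g, leftHit_apply f, ← contractFst_lTensor, ← coassoc_apply,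
    contractFst_contractFst_assoc, contractFst_rTensor]
  rfl

/-- Coassociativity once more, obtained by pairing with an arbitrary functional and transposing
`leftHit_leftHit`. -/
lemma leftHit_rightHit (f g : Dual k H) (x : H) :
    leftHit f (rightHit g x) = rightHit g (leftHit f x) := by
  rw [← sub_eq_zero, ← Module.forall_dual_apply_eq_zero_iff k]
  intro h
  have h1 := apply_leftHit (h ∘ₗ leftHit f) g x
  rw [← leftHit_leftHit, apply_leftHit] at h1
  rw [map_sub, sub_eq_zero]
  exact h1.symm

variable (k) in
/-- A left integral `Λ` of a Hopf algebra, normalized by `ε(Λ) = 1`. -/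
structure IsNormalizedIntegral (Λ : H) : Prop where
  mul_eq : ∀ h : H, h * Λ = counit (R := k) h • Λ
  counit_eq : counit (R := k) Λ = 1

variable (k H) in
/-- A semisimple Hopf algebra has a normalized left integral. -/
theorem exists_isNormalizedIntegral [IsSemisimpleRing H] :
    ∃ Λ : H, IsNormalizedIntegral k Λ := by
  let ε := Bialgebra.counitAlgHom k H
  obtain ⟨J, hJ⟩ := exists_isCompl (RingHom.ker ε : Submodule H H)
  obtain ⟨a, ha, b, hb, hab⟩ := Submodule.mem_sup.1
    (hJ.sup_eq_top ▸ Submodule.mem_top : (1 : H) ∈ (RingHom.ker ε : Submodule H H) ⊔ J)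
  have hεb : ε b = 1 := by
    have := congr(ε $hab)
    rw [map_add, RingHom.mem_ker.1 ha, zero_add, map_one] at this
    exact this
  refine ⟨b, fun h => ?_, hεb⟩
  -- The difference is killed by ε because ε(b) = 1, and lies in `J` because `J` is a left ideal;
  -- the two meet in 0.
  have h1 : h * b - counit (R := k) h • b ∈ (RingHom.ker ε : Submodule H H) ⊓ J := by
    refine ⟨?_, ?_⟩
    · change ε _ = 0
      rw [map_sub, map_mul, map_smul, hεb]
      simp [ε]
    · rw [Algebra.smul_def]
      exact J.sub_mem (J.smul_mem h hb) (J.smul_mem _ hb)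
  rw [hJ.inf_eq_bot] at h1
  exact sub_eq_zero.1 ((Submodule.mem_bot _).1 h1)

namespace IsNormalizedIntegral

variable {Λ : H} (hΛ : IsNormalizedIntegral k Λ)
include hΛ

lemma comul_mul_comul (h : H) :
    comul (R := k) h * comul Λ = counit (R := k) h • comul Λ := by
  rw [← Bialgebra.comul_mul, hΛ.mul_eq, map_smul]

/-- Expand 1 ⊗ h as ∑ (S(h₁) ⊗ 1)Δ(h₂); the factor Δ(h₂) is absorbed by Δ(Λ) as ε(h₂). This identity
makes Δ(Λ) a nondegenerate tensor. -/
lemma one_tmul_mul_comul (h : H) :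
    ((1 : H) ⊗ₜ[k] h) * comul Λ = (antipode k h ⊗ₜ[k] (1 : H)) * comul Λ := by
  rw [← sum_antipode_tmul_mul_comul, Finset.sum_mul]
  simp_rw [mul_assoc, hΛ.comul_mul_comul, mul_smul_comm, ← smul_mul_assoc]
  rw [← Finset.sum_mul]
  congr 1
  conv_rhs => rw [← sum_counit_smul_left (k := k) h]
  simp [TensorProduct.sum_tmul, TensorProduct.smul_tmul']

lemma finite_and_bijective :
    FiniteDimensional k H ∧ Function.Bijective (contractFst (comul (R := k) Λ)) := by
  refine finite_and_bijective_contractFst _ (fun a => ⟨LinearMap.mulLeft k (antipode k a), ?_⟩)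
    (antipode k) ?_
  · rw [lTensor_mulLeft_eq, rTensor_mulLeft_eq, hΛ.one_tmul_mul_comul]
  · rw [mul_antipode_rTensor_comul_apply, hΛ.counit_eq, map_one]

lemma antipode_injective : Function.Injective (antipode k (A := H)) := by
  refine (injective_iff_map_eq_zero _).2 fun h hh => ?_
  obtain ⟨f, hf⟩ := hΛ.finite_and_bijective.2.2 1
  have h1 := congr(contractFst $(hΛ.one_tmul_mul_comul h) f)
  rw [hh, TensorProduct.zero_tmul, zero_mul, contractFst_zero, ← lTensor_mulLeft_eq,
    contractFst_lTensor, hf] at h1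
  simpa using h1

lemma antipode_bijective : Function.Bijective (antipode k (A := H)) := by
  have := hΛ.finite_and_bijective.1
  exact ⟨hΛ.antipode_injective, LinearMap.surjective_of_injective hΛ.antipode_injective⟩

/-- S(Λ) is a right integral since S is onto; evaluating S(Λ)Λ with the right integral S(Λ) and with
the left integral Λ gives the two sides. -/
lemma antipode_eq : antipode k Λ = Λ := by
  have h1 (h : H) : antipode k Λ * h = counit (R := k) h • antipode k Λ := by
    obtain ⟨h, rfl⟩ := hΛ.antipode_bijective.2 h
    rw [← antipode_mul_antidistrib, hΛ.mul_eq, map_smul, counit_antipode]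
  have h2 := h1 Λ
  rw [hΛ.mul_eq, counit_antipode, hΛ.counit_eq, one_smul, one_smul] at h2
  exact h2.symm

lemma mul_eq' (h : H) : Λ * h = counit (R := k) h • Λ := by
  obtain ⟨h, rfl⟩ := hΛ.antipode_bijective.2 h
  conv_lhs => rw [← hΛ.antipode_eq]
  rw [← antipode_mul_antidistrib, hΛ.mul_eq, map_smul, counit_antipode, hΛ.antipode_eq]

lemma comul_mul_comul' (h : H) :
    comul (R := k) Λ * comul h = counit (R := k) h • comul Λ := by
  rw [← Bialgebra.comul_mul, hΛ.mul_eq', map_smul]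

lemma comul_mul_tmul_one (h : H) :
    comul Λ * (h ⊗ₜ[k] (1 : H)) = comul Λ * ((1 : H) ⊗ₜ[k] antipode k h) := by
  rw [← sum_comul_mul_tmul_antipode, Finset.mul_sum]
  simp_rw [← mul_assoc, hΛ.comul_mul_comul', smul_mul_assoc, ← mul_smul_comm]
  rw [← Finset.mul_sum]
  congr 1
  conv_rhs => rw [← sum_counit_smul (R := k) (ℛ k h)]
  simp [TensorProduct.tmul_sum]

/-- The contraction isomorphism `f ↦ f(Λ₁)Λ₂`. -/
def contractEquiv : Dual k H ≃ₗ[k] H :=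
  LinearEquiv.ofBijective (contractFst (comul (R := k) Λ)) hΛ.finite_and_bijective.2

/-- The right integral `λ` on `H` with `λ(Λ₁)Λ₂ = 1`. -/
def cointegral : Dual k H := hΛ.contractEquiv.symm 1

lemma contractFst_cointegral : contractFst (comul (R := k) Λ) hΛ.cointegral = 1 :=
  hΛ.contractEquiv.apply_symm_apply 1

lemma contractFst_injective : Function.Injective (contractFst (comul (R := k) Λ)) :=
  hΛ.finite_and_bijective.2.1

end IsNormalizedIntegral

end HopfAlgebra

end

/-! ### Radford's trace formula and the fourth power of the antipode -/

noncomputable section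

open Module

namespace HopfAlgebra

open Coalgebra

variable {k : Type*} {H : Type*} [Field k] [Ring H] [HopfAlgebra k H]

namespace IsNormalizedIntegral

variable {Λ : H} (hΛ : IsNormalizedIntegral k Λ)
include hΛ

/-- A functional is determined by its contraction against Δ(Λ), so after pairing with `f` it
suffices to compare contractions, which coassociativity and λ(Λ₁)Λ₂ = 1 evaluate. -/
lemma leftHit_cointegral (x : H) : leftHit hΛ.cointegral x = hΛ.cointegral x • 1 := by
  rw [← sub_eq_zero, ← Module.forall_dual_apply_eq_zero_iff k]
  intro f
  rw [map_sub, sub_eq_zero, map_smul, smul_eq_mul]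
  have : f ∘ₗ leftHit hΛ.cointegral = f 1 • hΛ.cointegral := by
    apply hΛ.contractFst_injective
    rw [map_smul, contractFst_cointegral, ← leftHit_apply, ← leftHit_leftHit,
      leftHit_apply hΛ.cointegral, contractFst_cointegral, leftHit_apply]
    simp [Algebra.TensorProduct.one_def]
  rw [mul_comm]
  exact congr($this x)

lemma cointegral_apply : hΛ.cointegral Λ = 1 := by
  have h := congr(counit (R := k) $(hΛ.leftHit_cointegral Λ))
  rw [leftHit_apply, contractFst_cointegral] at h
  simpa using h.symm

lemma contractFst_cointegral_mulLeft (h : H) :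
    contractFst (comul (R := k) Λ) (hΛ.cointegral ∘ₗ LinearMap.mulLeft k (antipode k h)) = h := by
  rw [← contractFst_rTensor, rTensor_mulLeft_eq, ← hΛ.one_tmul_mul_comul, ← lTensor_mulLeft_eq,
    contractFst_lTensor, contractFst_cointegral, LinearMap.mulLeft_apply, mul_one]

lemma contractFst_cointegral_mulRight (h : H) :
    contractFst (comul (R := k) Λ) (hΛ.cointegral ∘ₗ LinearMap.mulRight k h) = antipode k h := by
  rw [← contractFst_rTensor, rTensor_mulRight_eq, hΛ.comul_mul_tmul_one, ← lTensor_mulRight_eq,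
    contractFst_lTensor, contractFst_cointegral, LinearMap.mulRight_apply, one_mul]

/-- The square of the antipode is the Nakayama automorphism of the cointegral. -/
lemma cointegral_mul (y h : H) :
    hΛ.cointegral (y * h) = hΛ.cointegral (antipode k (antipode k h) * y) := by
  have : hΛ.cointegral ∘ₗ LinearMap.mulRight k h =
      hΛ.cointegral ∘ₗ LinearMap.mulLeft k (antipode k (antipode k h)) := by
    apply hΛ.contractFst_injective
    rw [contractFst_cointegral_mulRight, contractFst_cointegral_mulLeft]
  exact congr($this y)

lemma eq_of_cointegral_mul_eq {x y : H}
    (h : ∀ z, hΛ.cointegral (x * z) = hΛ.cointegral (y * z)) : x = y := by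
  obtain ⟨x, rfl⟩ := hΛ.antipode_bijective.2 x
  obtain ⟨y, rfl⟩ := hΛ.antipode_bijective.2 y
  congr 1
  rw [← hΛ.contractFst_cointegral_mulLeft x, ← hΛ.contractFst_cointegral_mulLeft y]
  congr 1
  ext z
  exact h z

/-- The trace of `y ↦ S⁻²(y) x` is `λ(S(x))`. -/
lemma trace_mulRight_comp (τ : H →ₗ[k] H) (hτ : ∀ y, antipode k (antipode k (τ y)) = y) (x : H) :
    LinearMap.trace k H (LinearMap.mulRight k x ∘ₗ τ) = hΛ.cointegral (antipode k x) := by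
  have := hΛ.finite_and_bijective.1
  let Ψ : H →ₗ[k] Dual k H :=
    LinearMap.compRight k hΛ.cointegral ∘ₗ LinearMap.mul k H ∘ₗ antipode k
  let G := LinearMap.mulRight k x ∘ₗ τ
  -- Applying G to y = λ(S(y)Λ₁)Λ₂ presents G as a finite-rank sum, with trace λ(S(G(Λ₂))Λ₁) =
  -- λ(S(x) · Sτ(Λ₂)Λ₁).
  have h1 : G = contractFst (G.lTensor H (comul (R := k) Λ)) ∘ₗ Ψ := by
    refine LinearMap.ext fun y => ?_
    change G y = contractFst (G.lTensor H (comul (R := k) Λ)) (Ψ y)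
    rw [contractFst_lTensor]
    congr 1
    exact (hΛ.contractFst_cointegral_mulLeft y).symm
  change LinearMap.trace k H G = _
  rw [h1, trace_contractFst]
  have h2 (T : H ⊗[k] H) : TensorProduct.lift Ψ.flip (G.lTensor H T) =
      hΛ.cointegral (antipode k x * LinearMap.mul' k H (TensorProduct.comm k H H
        ((antipode k ∘ₗ τ).lTensor H T))) := by
    induction T with
    | zero => simp
    | tmul a b => simp [Ψ, G, antipode_mul_antidistrib, mul_assoc]
    | add x y hx hy => simp [hx, hy, mul_add]
  have h3 (T : H ⊗[k] H) : antipode k (LinearMap.mul' k H (TensorProduct.comm k H H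
        ((antipode k ∘ₗ τ).lTensor H T))) = LinearMap.mul' k H ((antipode k).rTensor H T) := by
    induction T with
    | zero => simp
    | tmul a b => simp [antipode_mul_antidistrib, hτ]
    | add x y hx hy => simp [hx, hy]
  -- Sτ(Λ₂)Λ₁ = 1, because its image under S is S(Λ₁)Λ₂ = ε(Λ)1.
  have h4 : LinearMap.mul' k H (TensorProduct.comm k H H
        ((antipode k ∘ₗ τ).lTensor H (comul (R := k) Λ))) = 1 := by
    apply hΛ.antipode_injective
    rw [h3, mul_antipode_rTensor_comul_apply, hΛ.counit_eq, map_one, antipode_one]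
  rw [h2, h4, mul_one]

/-- The distinguished group-like element `Λ₁ λ(Λ₂)`. -/
def distinguished : H := rightHit hΛ.cointegral Λ

lemma rightHit_cointegral (x : H) :
    rightHit hΛ.cointegral x = hΛ.cointegral x • hΛ.distinguished := by
  rw [← sub_eq_zero, ← Module.forall_dual_apply_eq_zero_iff k]
  intro f
  rw [map_sub, sub_eq_zero, map_smul, smul_eq_mul, ← apply_leftHit]
  have : hΛ.cointegral ∘ₗ leftHit f = f hΛ.distinguished • hΛ.cointegral := by
    apply hΛ.contractFst_injective
    rw [map_smul, contractFst_cointegral, ← leftHit_apply, ← leftHit_leftHit,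
      leftHit_cointegral, apply_leftHit]
    rfl
  rw [mul_comm]
  exact congr($this x)

lemma isGroupLikeElem_distinguished : IsGroupLikeElem k hΛ.distinguished where
  counit_eq_one := by
    have h : counit (R := k) (rightHit hΛ.cointegral Λ) = hΛ.cointegral (leftHit counit Λ) :=
      (apply_leftHit _ _ _).symm
    rw [distinguished, h, leftHit_apply, contractFst_def, rTensor_counit_comul]
    simp [hΛ.cointegral_apply]
  comul_eq_tmul_self := by
    refine contractFst_ext fun f => ?_
    rw [← leftHit_apply, contractFst_tmul]
    conv_lhs => rw [distinguished, leftHit_rightHit, rightHit_cointegral, apply_leftHit]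
    rfl

/-- Evaluate λ(S(y)Λ₁) λ(gΛ₂) in two ways: contracting the first leg leaves λ(gy), and contracting
the second leaves λ(S(y)), since Λ₁λ(gΛ₂) = 1. -/
lemma cointegral_antipode (y : H) :
    hΛ.cointegral (antipode k y) = hΛ.cointegral (hΛ.distinguished * y) := by
  set g := hΛ.distinguished with hg
  have hgl := hΛ.isGroupLikeElem_distinguished
  have h1 : contractSnd (comul (R := k) Λ) (hΛ.cointegral ∘ₗ LinearMap.mulLeft k g) = 1 := by
    -- As g is group-like, the left factor is Δ(g), absorbed by Δ(Λ) as ε(g) = 1.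
    have h2 : ((g ⊗ₜ[k] (1 : H)) * (((1 : H) ⊗ₜ[k] g) * comul (R := k) Λ)) = comul (R := k) Λ := by
      rw [← mul_assoc, Algebra.TensorProduct.tmul_mul_tmul, one_mul, mul_one,
        ← hgl.comul_eq_tmul_self, hΛ.comul_mul_comul, hgl.counit_eq_one, one_smul]
    have h3 := congr(contractSnd $h2 hΛ.cointegral)
    rw [← rTensor_mulLeft_eq, contractSnd_rTensor, ← lTensor_mulLeft_eq, contractSnd_lTensor,
      LinearMap.mulLeft_apply] at h3
    have h4 : contractSnd (comul (R := k) Λ) hΛ.cointegral = g := rfl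
    rw [h4] at h3
    exact hgl.isUnit.mul_left_cancel (h3.trans (mul_one g).symm)
  have h5 := apply_contractFst (comul (R := k) Λ)
    (hΛ.cointegral ∘ₗ LinearMap.mulLeft k (antipode k y)) (hΛ.cointegral ∘ₗ LinearMap.mulLeft k g)
  rw [h1, contractFst_cointegral_mulLeft] at h5
  simpa using h5.symm

/-- Radford's formula for the fourth power of the antipode (unimodular case). -/
lemma antipode_pow_four_mul (a : H) :
    antipode k (antipode k (antipode k (antipode k a))) * hΛ.distinguished =
      hΛ.distinguished * a := by
  apply hΛ.eq_of_cointegral_mul_eq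
  intro b
  -- λ(S³(a)S(b)) is computed twice, from λ ∘ S = λ(g ·) at ab and at bS²(a); moving a right factor
  -- to the left costs an S².
  have h1 := hΛ.cointegral_antipode (a * b)
  have h2 := hΛ.cointegral_antipode (b * antipode k (antipode k a))
  rw [antipode_mul_antidistrib] at h1 h2
  rw [hΛ.cointegral_mul] at h1
  rw [← mul_assoc] at h1 h2
  rw [hΛ.cointegral_mul _ (antipode k (antipode k a))] at h2
  rw [← h1, mul_assoc, ← h2]

end IsNormalizedIntegral

/-- Group-likes are linearly independent, so in finite dimension they form a finite group. -/
lemma _root_.IsGroupLikeElem.isOfFinOrder [FiniteDimensional k H] {g : H}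
    (hg : IsGroupLikeElem k g) : IsOfFinOrder g := by
  have hfin : Finite (GroupLike k H) := (linearIndep_groupLikeVal (R := k) (A := H)).finite
  have := isOfFinOrder_of_finite (⟨g, hg⟩ : GroupLike k H)
  exact (GroupLike.valMonoidHom (R := k) (A := H)).isOfFinOrder this

/-- The square of the antipode as an algebra endomorphism. -/
def antipodeSq (k H : Type*) [Field k] [Ring H] [HopfAlgebra k H] : H →ₐ[k] H :=
  AlgHom.ofLinearMap (antipode k ∘ₗ antipode k) (by simp)
    (by simp [antipode_mul_antidistrib])

lemma IsNormalizedIntegral.exists_antipodeSq_pow_eq_one {Λ : H} (hΛ : IsNormalizedIntegral k Λ) :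
    ∃ m, 0 < m ∧ antipodeSq k H ^ m = 1 := by
  have := hΛ.finite_and_bijective.1
  obtain ⟨N, hN, hgN⟩ := isOfFinOrder_iff_pow_eq_one.1 hΛ.isGroupLikeElem_distinguished.isOfFinOrder
  -- Iterating S⁴(a)g = ga up to the order N of g gives S⁴ᴺ = 1, which is the power 2N of S².
  refine ⟨2 * N, by lia, ?_⟩
  have key (j : ℕ) (a : H) : ((antipodeSq k H ^ 2) ^ j) a * hΛ.distinguished ^ j =
      hΛ.distinguished ^ j * a := by
    induction j generalizing a with
    | zero => simp
    | succ j ih =>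
      have h := hΛ.antipode_pow_four_mul a
      rw [pow_succ (antipodeSq k H ^ 2), AlgHom.mul_apply, pow_succ hΛ.distinguished, ← mul_assoc,
        ih, mul_assoc, mul_assoc, ← h]
      rfl
  ext a
  have h := key N a
  rw [hgN, mul_one, one_mul] at h
  rw [pow_mul]
  exact h

end HopfAlgebra

end

/-! ### Sums of roots of unity and traces of finite-order operators -/

noncomputable section

open Module

section RootsOfUnity

variable {k : Type*} [Field k] [CharZero k]

/-- A sum of "absolute squares" of sums of roots of unity vanishes only if every term does. -/
lemma sum_eq_zero_of_sum_mul_sum_inv_eq_zero {ι : Type*} [Fintype ι] {m : ℕ} (hm : 0 < m)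
    (Z : ι → Multiset k) (hZ : ∀ i, ∀ z ∈ Z i, z ^ m = 1)
    (h : ∑ i, (Z i).sum * ((Z i).map (·⁻¹)).sum = 0) (i : ι) : (Z i).sum = 0 := by
  -- The field itself need not embed in ℂ, but roots of unity are algebraic over ℚ, and their
  -- inverses become complex conjugates.
  let F := algebraicClosure ℚ k
  have : Algebra.IsAlgebraic ℚ F := by convert! algebraicClosure.isAlgebraic ℚ k
  let φ : F →ₐ[ℚ] ℂ := IsAlgClosed.lift
  have hW (i) : ∃ W : Multiset F, W.map (algebraMap F k) = Z i := by
    have hmem : ∀ z ∈ Z i, z ∈ F := by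
      intro z hz
      rw [mem_algebraicClosure_iff]
      refine IsIntegral.isAlgebraic (IsIntegral.of_pow hm ?_)
      rw [hZ i z hz]
      exact isIntegral_one
    lift Z i to Multiset F using hmem with W hW
    exact ⟨W, rfl⟩
  choose W hW using hW
  have hWm (i) (w : F) (hw : w ∈ W i) : w ^ m = 1 := by
    apply (algebraMap F k).injective
    rw [map_pow, map_one]
    exact hZ i _ (hW i ▸ Multiset.mem_map_of_mem _ hw)
  have h1 (i) : (Z i).sum = algebraMap F k (W i).sum := by
    rw [← hW, map_multiset_sum]
  have h2 (i) : ((Z i).map (·⁻¹)).sum = algebraMap F k ((W i).map (·⁻¹)).sum := by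
    rw [← hW, map_multiset_sum, Multiset.map_map, Multiset.map_map]
    simp [Function.comp_def]
  have h3 : ∑ i, (W i).sum * ((W i).map (·⁻¹)).sum = 0 := by
    apply (algebraMap F k).injective
    rw [map_sum, map_zero, ← h]
    exact Finset.sum_congr rfl fun i _ => by rw [map_mul, h1, h2]
  have h4 (i) : φ ((W i).map (·⁻¹)).sum = (starRingEnd ℂ) (φ (W i).sum) := by
    rw [map_multiset_sum, map_multiset_sum, map_multiset_sum, Multiset.map_map, Multiset.map_map]
    congr 1
    refine Multiset.map_congr rfl fun w hw => ?_
    have hw1 : φ w ^ m = 1 := by rw [← map_pow, hWm i w hw, map_one]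
    simp only [Function.comp_apply, map_inv₀]
    exact Complex.inv_eq_conj (Complex.norm_eq_one_of_pow_eq_one hw1 hm.ne')
  have h5 : ∑ i, Complex.normSq (φ (W i).sum) = 0 := by
    have := congr(φ $h3)
    rw [map_sum, map_zero] at this
    simp_rw [map_mul, h4, Complex.mul_conj] at this
    exact_mod_cast this
  have h6 := (Finset.sum_eq_zero_iff_of_nonneg fun i _ => Complex.normSq_nonneg _).1 h5 i
    (Finset.mem_univ i)
  rw [Complex.normSq_eq_zero, map_eq_zero] at h6
  rw [h1, h6, map_zero]

end RootsOfUnity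

section Trace

variable {k V : Type*} [Field k] [AddCommGroup V] [Module k V] [FiniteDimensional k V]

/-- Under End V ≅ V* ⊗ V the operator becomes Uᵗ ⊗ T, and the trace is multiplicative on tensor
products. -/
lemma LinearMap.trace_mulLeft_comp_mulRight (T U : End k V) :
    trace k (End k V) (mulLeft k T ∘ₗ mulRight k U) = trace k V T * trace k V U := by
  have h : mulLeft k T ∘ₗ mulRight k U =
      (dualTensorHomEquiv k V V).conj (TensorProduct.map (Dual.transpose (R := k) U) T) := by
    have h' : (mulLeft k T ∘ₗ mulRight k U) ∘ₗ (dualTensorHomEquiv k V V).toLinearMap =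
        (dualTensorHomEquiv k V V).toLinearMap ∘ₗ
          TensorProduct.map (Dual.transpose (R := k) U) T := by
      ext f v x
      simp [Dual.transpose_apply]
    refine LinearMap.ext fun x => ?_
    obtain ⟨t, rfl⟩ := (dualTensorHomEquiv k V V).surjective x
    rw [LinearEquiv.conj_apply_apply, LinearEquiv.symm_apply_apply]
    exact congr($h' t)
  rw [h, mul_comm]
  have h2 := trace_conj' (R := k) (M := Dual k V ⊗[k] V) (N := V →ₗ[k] V)
    (TensorProduct.map (Dual.transpose (R := k) U) T) (dualTensorHomEquiv k V V)
  refine h2.trans ?_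
  rw [trace_tensorProduct', trace_transpose']

/-- The traces of an endomorphism of finite order and of its inverse. -/
lemma Module.End.exists_trace_eq_sum_of_pow_eq_one [IsAlgClosed k] [CharZero k] {m : ℕ}
    (hm : 0 < m) {u v : End k V} (hu : u ^ m = 1) (hvu : v * u = 1) :
    ∃ Z : Multiset k, (∀ z ∈ Z, z ^ m = 1) ∧ LinearMap.trace k V u = Z.sum ∧
      LinearMap.trace k V v = (Z.map (·⁻¹)).sum := by
  have hss : u.IsSemisimple := by
    refine isSemisimple_of_squarefree_aeval_eq_zero (p := Polynomial.X ^ m - 1) ?_ (by simp [hu])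
    exact (Polynomial.separable_X_pow_sub_C (1 : k)
      (by exact_mod_cast hm.ne') one_ne_zero).squarefree
  classical
  have hint : DirectSum.IsInternal (fun μ : k => u.eigenspace μ) := by
    rw [DirectSum.isInternal_submodule_iff_iSupIndep_and_iSup_eq_top]
    exact ⟨u.eigenspaces_iSupIndep, hss.iSup_eigenspace_eq_top⟩
  have hfin : {μ : k | u.eigenspace μ ≠ ⊥}.Finite :=
    WellFoundedGT.finite_ne_bot_of_iSupIndep u.eigenspaces_iSupIndep
  have hone (μ : k) (hμ : u.eigenspace μ ≠ ⊥) : μ ^ m = 1 := by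
    obtain ⟨x, hx, hx0⟩ := Submodule.exists_mem_ne_zero_of_ne_bot hμ
    have h1 : (u ^ m) x = μ ^ m • x :=
      HasEigenvector.pow_apply ⟨hx, hx0⟩ m
    rw [hu, End.one_apply] at h1
    by_contra h
    apply hx0
    have : (μ ^ m - 1) • x = 0 := by rw [sub_smul, ← h1, one_smul, sub_self]
    exact (smul_eq_zero.1 this).resolve_left (sub_ne_zero.2 h)
  have hvx (μ : k) (x) (hx : x ∈ u.eigenspace μ) : v x = μ⁻¹ • x := by
    by_cases hx0 : x = 0
    · simp [hx0]
    have hμ : μ ≠ 0 := by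
      rintro rfl
      have := hone 0 (fun h => hx0 (by simpa [h] using hx))
      simp [hm.ne'] at this
    have h1 := congr($hvu x)
    rw [End.mul_apply, mem_eigenspace_iff.1 hx, map_smul, End.one_apply] at h1
    conv_rhs => rw [← h1]
    rw [smul_smul, inv_mul_cancel₀ hμ, one_smul]
  have key (w : End k V) (c : k → k) (hw : ∀ μ, ∀ x ∈ u.eigenspace μ, w x = c μ • x) :
      LinearMap.trace k V w = ∑ μ ∈ hfin.toFinset, finrank k (u.eigenspace μ) • c μ := by
    have hmaps (μ) : Set.MapsTo w (u.eigenspace μ) (u.eigenspace μ) := fun x hx => by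
      rw [hw μ x hx]; exact Submodule.smul_mem _ _ hx
    rw [LinearMap.trace_eq_sum_trace_restrict' hint hfin hmaps]
    refine Finset.sum_congr rfl fun μ _ => ?_
    have : w.restrict (hmaps μ) = c μ • LinearMap.id := by
      ext x
      exact hw μ x x.2
    rw [this, map_smul, LinearMap.trace_id, smul_eq_mul, nsmul_eq_mul, mul_comm]
  -- The eigenvalues of `u` with multiplicity; `v` acts on each eigenspace by the inverse scalar.
  refine ⟨∑ μ ∈ hfin.toFinset, Multiset.replicate (finrank k (u.eigenspace μ)) μ, ?_, ?_, ?_⟩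
  · intro z hz
    obtain ⟨μ, hμ, hz⟩ := Multiset.mem_sum.1 hz
    rw [Multiset.eq_of_mem_replicate hz]
    exact hone μ (by simpa using hμ)
  · rw [key u id fun μ x hx => mem_eigenspace_iff.1 hx, Multiset.sum_sum]
    simp
  · have := map_sum (Multiset.mapAddMonoidHom (·⁻¹ : k → k))
      (fun μ => Multiset.replicate (finrank k (u.eigenspace μ)) μ) hfin.toFinset
    simp only [Multiset.coe_mapAddMonoidHom] at this
    rw [key v (·⁻¹) hvx, this, Multiset.sum_sum]
    simp

end Trace

end

/-! ### Finite-order endomorphisms of semisimple algebras -/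

noncomputable section

open Module

section Blocks

variable {k V : Type*} [Field k] [IsAlgClosed k] [AddCommGroup V] [Module k V]
  [FiniteDimensional k V]

/-- An algebra automorphism of finite order of `End V` is conjugation by an automorphism of finite
order. -/
lemma AlgEquiv.exists_conj_of_pow_eq_one {m : ℕ} (hm : 0 < m) (f : End k V ≃ₐ[k] End k V)
    (hf : f ^ m = 1) :
    ∃ T U : End k V, T ^ m = 1 ∧ U * T = 1 ∧ T * U = 1 ∧ ∀ x, f x = T * x * U := by
  obtain ⟨T, rfl⟩ := f.eq_linearEquivConjAlgEquiv
  have hT (x : End k V) : T.conjAlgEquiv k x = T.toLinearMap * x * T.symm.toLinearMap := rfl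
  have hTT : T.toLinearMap * T.symm.toLinearMap = (1 : End k V) := by ext; simp
  have hTT' : T.symm.toLinearMap * T.toLinearMap = (1 : End k V) := by ext; simp
  have hpow (j : ℕ) (x : End k V) : ((T.conjAlgEquiv k) ^ j) x * T.toLinearMap ^ j =
      T.toLinearMap ^ j * x := by
    induction j generalizing x with
    | zero => simp
    | succ j ih =>
      rw [pow_succ (T.conjAlgEquiv k), AlgEquiv.mul_apply, pow_succ, ← mul_assoc, ih, hT]
      simp only [mul_assoc]
      rw [hTT', mul_one]
  have hcent : (T.toLinearMap : End k V) ^ m ∈ Set.center (End k V) := by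
    rw [Semigroup.mem_center_iff]
    intro x
    have := hpow m x
    rwa [hf] at this
  obtain ⟨c, hc, hTc⟩ := Module.End.mem_center_iff.1 hcent
  rcases subsingleton_or_nontrivial V with hV | hV
  · exact ⟨1, 1, one_pow _, one_mul _, one_mul _, fun x => Subsingleton.elim _ _⟩
  have hTc' : (T.toLinearMap : End k V) ^ m = c • 1 := by
    rw [hTc]
    ext x
    simp
  have hc0 : c ≠ 0 := by
    rintro rfl
    rw [zero_smul] at hTc'
    have hu : IsUnit (T.toLinearMap : End k V) := ⟨⟨_, _, hTT, hTT'⟩, rfl⟩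
    exact (hu.pow m).ne_zero hTc'
  -- `T ^ m` is central, hence a scalar `c`; dividing `T` by an m-th root of `c` makes its order
  -- finite without changing the conjugation.
  obtain ⟨d, hd⟩ := IsAlgClosed.exists_pow_nat_eq c hm
  have hd0 : d ≠ 0 := by
    rintro rfl
    exact hc0 (by rw [← hd, zero_pow hm.ne'])
  refine ⟨d⁻¹ • T.toLinearMap, d • T.symm.toLinearMap, ?_, ?_, ?_, fun x => ?_⟩
  · rw [smul_pow, hTc', smul_smul, inv_pow, hd, inv_mul_cancel₀ hc0, one_smul]
  · rw [smul_mul_smul_comm, hTT', mul_inv_cancel₀ hd0, one_smul]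
  · rw [smul_mul_smul_comm, hTT, inv_mul_cancel₀ hd0, one_smul]
  · rw [smul_mul_assoc, smul_mul_smul_comm, inv_mul_cancel₀ hd0, one_smul, hT]

/-- The trace of a multiplicative endomorphism of finite order of `End V`. -/
lemma exists_trace_eq_sum_mul_sum_inv [CharZero k] {m : ℕ} (hm : 0 < m) (f : End k V →ₗ[k] End k V)
    (hmul : ∀ x y, f (x * y) = f x * f y) (hf : f 1 = 1 → f ^ m = 1) :
    ∃ Z : Multiset k, (∀ z ∈ Z, z ^ m = 1) ∧
      LinearMap.trace k _ f = Z.sum * (Z.map (·⁻¹)).sum ∧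
      (Z.sum = 0 → ∀ x, LinearMap.trace k _ (LinearMap.mulRight k x ∘ₗ f) = 0) := by
  -- Zero is what a block moved elsewhere contributes. Otherwise simplicity of End V makes `f` an
  -- automorphism.
  by_cases hf0 : f = 0
  · exact ⟨0, by simp [hf0]⟩
  have hinj : Function.Injective f := by
    by_cases hV : Subsingleton V
    · exact Function.injective_of_subsingleton _
    have hV' : Nontrivial V := not_subsingleton_iff_nontrivial.1 hV
    have : Nonempty (Fin (finrank k V)) := ⟨⟨0, finrank_pos⟩⟩
    have : IsSimpleRing (End k V) :=
      IsSimpleRing.of_ringEquiv (algEquivMatrix (finBasis k V)).symm.toRingEquiv inferInstance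
    let I : TwoSidedIdeal (End k V) := .mk' (LinearMap.ker f) (Submodule.zero_mem _)
      (fun h h' => Submodule.add_mem _ h h') (fun h => Submodule.neg_mem _ h)
      (fun {x y} (h : f y = 0) => show f (x * y) = 0 by rw [hmul, h, mul_zero])
      (fun {x y} (h : f x = 0) => show f (x * y) = 0 by rw [hmul, h, zero_mul])
    have hI (x) : x ∈ I ↔ f x = 0 := TwoSidedIdeal.mem_mk' ..
    rcases eq_bot_or_eq_top I with h | h
    · refine (injective_iff_map_eq_zero f).2 fun x hx => ?_
      rw [← hI, h] at hx
      simpa using hx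
    · refine absurd (LinearMap.ext fun x => ?_) hf0
      exact (hI x).1 (h ▸ trivial)
  have hsurj : Function.Surjective f := LinearMap.surjective_of_injective hinj
  have h1 : f 1 = 1 := by
    obtain ⟨y, hy⟩ := hsurj 1
    calc f 1 = f 1 * f y := by rw [hy, mul_one]
      _ = f y := by rw [← hmul, one_mul]
      _ = 1 := hy
  let F : End k V ≃ₐ[k] End k V :=
    .ofBijective (AlgHom.ofLinearMap f h1 hmul) ⟨hinj, hsurj⟩
  have hF (j : ℕ) (x) : (F ^ j) x = (f ^ j) x := by
    induction j generalizing x with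
    | zero => simp
    | succ j ih =>
      rw [pow_succ, pow_succ, AlgEquiv.mul_apply, End.mul_apply, ih]
      rfl
  obtain ⟨T, U, hT, hUT, hTU, hTx⟩ := F.exists_conj_of_pow_eq_one hm (by
    ext x : 1
    rw [hF, hf h1]
    rfl)
  have key (x : End k V) : LinearMap.trace k _ (LinearMap.mulRight k x ∘ₗ f) =
      LinearMap.trace k V T * LinearMap.trace k V (U * x) := by
    rw [← LinearMap.trace_mulLeft_comp_mulRight]
    congr 1
    refine LinearMap.ext fun y => ?_
    change F y * x = T * (y * (U * x))
    rw [hTx]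
    simp only [mul_assoc]
  obtain ⟨Z, hZ, hZT, hZU⟩ := End.exists_trace_eq_sum_of_pow_eq_one hm hT hUT
  refine ⟨Z, hZ, ?_, fun h0 x => ?_⟩
  · have := key 1
    rw [mul_one, LinearMap.mulRight_one, hZT, hZU] at this
    exact this
  · rw [key, hZT, h0, zero_mul]

end Blocks

section Semisimple

variable {k A : Type*} [Field k] [IsAlgClosed k] [CharZero k] [Ring A] [Algebra k A]

lemma trace_mulRight_comp_eq_zero_of_pi {ι : Type*} [Fintype ι] {V : ι → Type*}
    [∀ i, AddCommGroup (V i)] [∀ i, Module k (V i)] [∀ i, FiniteDimensional k (V i)]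
    {m : ℕ} (hm : 0 < m) (σ : (Π i, End k (V i)) →ₐ[k] (Π i, End k (V i))) (hσ : σ ^ m = 1)
    (h0 : LinearMap.trace k _ σ.toLinearMap = 0) (x : Π i, End k (V i)) :
    LinearMap.trace k _ (LinearMap.mulRight k x ∘ₗ σ.toLinearMap) = 0 := by
  classical
  let B := Π i, End k (V i)
  let pr (i : ι) : B →ₗ[k] End k (V i) := LinearMap.proj i
  let inc (i : ι) : End k (V i) →ₗ[k] B := LinearMap.single k (fun i => End k (V i)) i
  have hsame (i) (a : End k (V i)) : inc i a i = a :=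
    Pi.single_eq_same (M := fun i => End k (V i)) i a
  have hne (i j) (hj : j ≠ i) (a : End k (V i)) : inc i a j = 0 :=
    Pi.single_eq_of_ne (M := fun i => End k (V i)) hj a
  have htr (g : B →ₗ[k] B) :
      LinearMap.trace k B g = ∑ i, LinearMap.trace k _ (pr i ∘ₗ g ∘ₗ inc i) := by
    have h1 : g = ∑ i, (inc i ∘ₗ pr i) ∘ₗ g := by
      refine LinearMap.ext fun y => ?_
      ext1 j
      rw [LinearMap.sum_apply, Finset.sum_apply, Finset.sum_eq_single j]
      · exact (hsame j (g y j)).symm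
      · exact fun i _ hij => hne i j hij.symm _
      · simp
    conv_lhs => rw [h1, map_sum]
    refine Finset.sum_congr rfl fun i _ => ?_
    rw [LinearMap.comp_assoc, LinearMap.trace_comp_comm', LinearMap.comp_assoc]
  let f (i : ι) : End k (V i) →ₗ[k] End k (V i) := pr i ∘ₗ σ.toLinearMap ∘ₗ inc i
  have hinc (i) (a b : End k (V i)) : inc i (a * b) = inc i a * inc i b := by
    ext1 j
    by_cases hj : j = i
    · subst hj
      rw [Pi.mul_apply, hsame, hsame, hsame]
    · rw [Pi.mul_apply, hne i j hj, hne i j hj, zero_mul]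
  have hf (i) (a b) : f i (a * b) = f i a * f i b := by
    change σ (inc i (a * b)) i = σ (inc i a) i * σ (inc i b) i
    rw [hinc, map_mul, Pi.mul_apply]
  have hfm (i) (h1 : f i 1 = 1) : f i ^ m = 1 := by
    -- If `f i` is unital, σ of the i-th central idempotent has i-th component 1, so only the i-th
    -- component of `y` matters, and powers of σ restrict to powers of `f i`.
    have h2 (y : B) : σ y i = f i (y i) := by
      have h3 : y * inc i 1 = inc i (y i) := by
        ext1 j
        by_cases hj : j = i
        · subst hj
          rw [Pi.mul_apply, hsame, hsame, mul_one]
        · rw [Pi.mul_apply, hne i j hj, hne i j hj, mul_zero]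
      calc σ y i = σ y i * f i 1 := by rw [h1, mul_one]
        _ = σ (y * inc i 1) i := by rw [map_mul]; rfl
        _ = f i (y i) := by rw [h3]; rfl
    have h4 (j : ℕ) (y : B) : (σ ^ j) y i = (f i ^ j) (y i) := by
      induction j generalizing y with
      | zero => simp
      | succ j ih => rw [pow_succ, AlgHom.mul_apply, ih, h2, pow_succ, End.mul_apply]
    refine LinearMap.ext fun a => ?_
    have h5 := h4 m (inc i a)
    rw [hσ, hsame] at h5
    exact h5.symm.trans (hsame i a)
  choose Z hZ hZf hZ0 using fun i => exists_trace_eq_sum_mul_sum_inv hm (f i) (hf i) (hfm i)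
  have hz := sum_eq_zero_of_sum_mul_sum_inv_eq_zero hm Z hZ (by
    rw [← h0, htr]
    exact Finset.sum_congr rfl fun i _ => (hZf i).symm)
  rw [htr]
  exact Finset.sum_eq_zero fun i _ => hZ0 i (hz i) (x i)

/-- If an endomorphism of finite order of a semisimple algebra has trace zero, then so does its
composition with any multiplication. -/
theorem trace_mulRight_comp_eq_zero [IsSemisimpleRing A] [FiniteDimensional k A]
    {m : ℕ} (hm : 0 < m) (σ : A →ₐ[k] A) (hσ : σ ^ m = 1)
    (h0 : LinearMap.trace k _ σ.toLinearMap = 0) (x : A) :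
    LinearMap.trace k _ (LinearMap.mulRight k x ∘ₗ σ.toLinearMap) = 0 := by
  obtain ⟨n, d, -, ⟨e₁⟩⟩ := IsSemisimpleRing.exists_algEquiv_pi_matrix_of_isAlgClosed k A
  let e : A ≃ₐ[k] Π i, End k (Fin (d i) → k) :=
    e₁.trans (AlgEquiv.piCongrRight fun i => Matrix.toLinAlgEquiv')
  let σ' := (e.toAlgHom.comp σ).comp e.symm.toAlgHom
  have hpow (j : ℕ) (y) : (σ' ^ j) (e y) = e ((σ ^ j) y) := by
    induction j generalizing y with
    | zero => simp
    | succ j ih =>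
      rw [pow_succ, pow_succ, AlgHom.mul_apply, AlgHom.mul_apply, ← ih]
      simp [σ']
  have hσ' : σ' ^ m = 1 := by
    refine AlgHom.ext fun y => ?_
    obtain ⟨y, rfl⟩ := e.surjective y
    rw [hpow, hσ]
    rfl
  have htr (x : A) : LinearMap.trace k _ (LinearMap.mulRight k (e x) ∘ₗ σ'.toLinearMap) =
      LinearMap.trace k _ (LinearMap.mulRight k x ∘ₗ σ.toLinearMap) := by
    rw [← LinearMap.trace_conj' (LinearMap.mulRight k x ∘ₗ σ.toLinearMap) e.toLinearEquiv]
    congr 1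
    refine LinearMap.ext fun y => ?_
    simp [σ', LinearEquiv.conj_apply_apply]
  rw [← htr]
  refine trace_mulRight_comp_eq_zero_of_pi hm σ' hσ' ?_ _
  have := htr 1
  rwa [map_one, LinearMap.mulRight_one, LinearMap.mulRight_one, LinearMap.id_comp,
    LinearMap.id_comp, h0] at this

end Semisimple

end

/-! ### The regular character and the Larson–Radford theorem -/

noncomputable section

open Module

namespace HopfAlgebra

open Coalgebra Algebra.TensorProduct

variable {k : Type*} {H : Type*} [Field k] [Ring H] [HopfAlgebra k H]

section RegularCharacter

/-- The map `x ⊗ y ↦ x₁ ⊗ y₁ F(x₂ ⊗ y₂)`. -/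
def tensorHit (F : Dual k (H ⊗[k] H)) : H ⊗[k] H →ₗ[k] H ⊗[k] H :=
  (TensorProduct.rid k (H ⊗[k] H)).toLinearMap ∘ₗ F.lTensor (H ⊗[k] H) ∘ₗ
    (TensorProduct.tensorTensorTensorComm k H H H H).toLinearMap ∘ₗ
      TensorProduct.map comul comul

lemma tensorHit_tmul (F : Dual k (H ⊗[k] H)) (x y : H) :
    tensorHit F (x ⊗ₜ[k] y) = contractSnd (TensorProduct.tensorTensorTensorComm k H H H H
      (comul (R := k) x ⊗ₜ[k] comul (R := k) y)) F := rfl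

lemma tensorHit_add (F G : Dual k (H ⊗[k] H)) :
    tensorHit (F + G) = tensorHit F + tensorHit G := by
  ext x y
  simp [tensorHit_tmul]

lemma tensorHit_dualDistrib (f g : Dual k H) :
    tensorHit (TensorProduct.dualDistrib k H H (f ⊗ₜ[k] g)) =
      TensorProduct.map (rightHit f) (rightHit g) := by
  have key (T U : H ⊗[k] H) : contractSnd (TensorProduct.tensorTensorTensorComm k H H H H
      (T ⊗ₜ[k] U)) (TensorProduct.dualDistrib k H H (f ⊗ₜ[k] g)) =
      contractSnd T f ⊗ₜ[k] contractSnd U g := by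
    induction T with
    | zero => simp
    | tmul a b =>
      induction U with
      | zero => simp
      | tmul c d => simp [TensorProduct.smul_tmul', smul_smul, mul_comm]
      | add x y hx hy => simp only [TensorProduct.tmul_add, map_add, contractSnd_add, hx, hy]
    | add x y hx hy =>
      simp only [TensorProduct.add_tmul, map_add, contractSnd_add, hx, hy]
  ext x y
  exact key _ _

variable (k H) in
/-- The map `x ⊗ y ↦ x₁ ⊗ x₂ y`. -/
def galoisMap : H ⊗[k] H →ₗ[k] H ⊗[k] H :=
  LinearMap.mul' k (H ⊗[k] H) ∘ₗ
    TensorProduct.map comul (includeRight : H →ₐ[k] H ⊗[k] H).toLinearMap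

variable (k H) in
/-- The map `x ⊗ y ↦ x₁ ⊗ S(x₂) y`. -/
def galoisInv : H ⊗[k] H →ₗ[k] H ⊗[k] H :=
  LinearMap.mul' k (H ⊗[k] H) ∘ₗ
    TensorProduct.map ((antipode k).lTensor H ∘ₗ comul)
      (includeRight : H →ₐ[k] H ⊗[k] H).toLinearMap

lemma galoisMap_tmul (x y : H) :
    galoisMap k H (x ⊗ₜ[k] y) = comul (R := k) x * ((1 : H) ⊗ₜ[k] y) := rfl

lemma galoisInv_tmul (x y : H) : galoisInv k H (x ⊗ₜ[k] y) =
    (antipode k).lTensor H (comul (R := k) x) * ((1 : H) ⊗ₜ[k] y) := rfl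

lemma galoisInv_mul (T : H ⊗[k] H) (y : H) :
    galoisInv k H (T * ((1 : H) ⊗ₜ[k] y)) = galoisInv k H T * ((1 : H) ⊗ₜ[k] y) := by
  induction T with
  | zero => simp
  | tmul a b => simp [galoisInv_tmul, mul_assoc]
  | add x y hx hy => simp [add_mul, hx, hy]

lemma galoisInv_comul (x : H) : galoisInv k H (comul (R := k) x) = x ⊗ₜ[k] 1 := by
  open WithConv LinearMap in
  have h1 : toConv ((antipode k).lTensor H ∘ₗ comul (R := k) (A := H)) =
      toConv (includeLeft : H →ₐ[k] H ⊗[k] H).toLinearMap *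
        toConv ((includeRight : H →ₐ[k] H ⊗[k] H).toLinearMap ∘ₗ antipode k) := by
    ext x
    rw [(ℛ k x).convMul_apply]
    change (antipode k).lTensor H (comul (R := k) x) = _
    conv_lhs => rw [← (ℛ k x).eq]
    simp
  open WithConv LinearMap in
  have h2 : toConv ((antipode k).lTensor H ∘ₗ comul (R := k) (A := H)) *
      toConv (includeRight : H →ₐ[k] H ⊗[k] H).toLinearMap =
        toConv (includeLeft : H →ₐ[k] H ⊗[k] H).toLinearMap := by
    rw [h1, mul_assoc, algHom_comp_antipode_convMul, mul_one]
  exact congr($h2 x)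

lemma galoisInv_comp_galoisMap : galoisInv k H ∘ₗ galoisMap k H = LinearMap.id := by
  ext x y
  simp [galoisMap_tmul, galoisInv_mul, galoisInv_comul]

/-- The Galois map identifies the tensor square of the regular comodule with dim H copies of it;
both composites send x ⊗ y to x₁ ⊗ x₂y₁ f(x₃y₂). -/
lemma galoisMap_comp_tensorHit (f : Dual k H) :
    galoisMap k H ∘ₗ tensorHit (f ∘ₗ LinearMap.mul' k H) =
      (rightHit f).lTensor H ∘ₗ galoisMap k H := by
  let Θ (U : H ⊗[k] H) : H ⊗[k] (H ⊗[k] H) →ₗ[k] H ⊗[k] H :=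
    LinearMap.lTensor H ((TensorProduct.rid k H).toLinearMap ∘ₗ f.lTensor H ∘ₗ
      LinearMap.mulRight k U)
  have hΘ (U : H ⊗[k] H) (a : H) (t : H ⊗[k] H) :
      Θ U (a ⊗ₜ[k] t) = a ⊗ₜ[k] contractSnd (t * U) f := rfl
  have hΘadd (U U' : H ⊗[k] H) (t) : Θ (U + U') t = Θ U t + Θ U' t := by
    induction t with
    | zero => simp
    | tmul a t => simp [hΘ, mul_add, TensorProduct.tmul_add]
    | add x y hx hy => rw [map_add, map_add, map_add, hx, hy]; abel
  have h1 (t : H ⊗[k] H) (b c d : H) : Θ (c ⊗ₜ[k] d) (TensorProduct.assoc k H H H (t ⊗ₜ[k] b)) =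
      f (b * d) • (t * ((1 : H) ⊗ₜ[k] c)) := by
    induction t with
    | zero => simp
    | tmul u v => simp [hΘ]
    | add x y hx hy => simp only [TensorProduct.add_tmul, map_add, hx, hy, add_mul, smul_add]
  have h2 (T U : H ⊗[k] H) : galoisMap k H (contractSnd
      (TensorProduct.tensorTensorTensorComm k H H H H (T ⊗ₜ[k] U)) (f ∘ₗ LinearMap.mul' k H)) =
      Θ U (TensorProduct.assoc k H H H ((comul (R := k)).rTensor H T)) := by
    induction T with
    | zero => simp
    | tmul a b =>
      induction U with
      | zero =>
        have : Θ 0 = 0 := by ext; simp [hΘ]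
        simp [this]
      | tmul c d => simp [h1, galoisMap_tmul]
      | add x y hx hy =>
        rw [TensorProduct.tmul_add, map_add, contractSnd_add, map_add, hx, hy, hΘadd]
    | add x y hx hy =>
      simp only [TensorProduct.add_tmul, map_add, contractSnd_add, hx, hy]
  have h3 (T : H ⊗[k] H) (y : H) : (rightHit f).lTensor H (T * ((1 : H) ⊗ₜ[k] y)) =
      Θ (comul (R := k) y) ((comul (R := k)).lTensor H T) := by
    induction T with
    | zero => simp
    | tmul a b => simp [hΘ, rightHit_apply]
    | add x y hx hy => simp only [add_mul, map_add, hx, hy]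
  ext x y
  change galoisMap k H (tensorHit _ (x ⊗ₜ[k] y)) =
    (rightHit f).lTensor H (galoisMap k H (x ⊗ₜ[k] y))
  rw [tensorHit_tmul, h2, galoisMap_tmul, h3, coassoc_apply]

variable [FiniteDimensional k H]

variable (k H) in
/-- The character of the regular comodule. -/
lemma exists_apply_eq_trace_rightHit :
    ∃ h : H, ∀ f : Dual k H, f h = LinearMap.trace k H (rightHit f) := by
  let t : Dual k (Dual k H) :=
    { toFun f := LinearMap.trace k H (rightHit f)
      map_add' f g := by
        rw [← map_add]; congr 1; ext x; simp [rightHit_apply]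
      map_smul' c f := by
        rw [RingHom.id_apply, ← map_smul]; congr 1; ext x; simp [rightHit_apply] }
  obtain ⟨h, hh⟩ := (Module.evalEquiv k H).surjective t
  exact ⟨h, fun f => congr($hh f)⟩

variable {h : H} (hh : ∀ f : Dual k H, f h = LinearMap.trace k H (rightHit f))
include hh

lemma trace_tensorHit (F : Dual k (H ⊗[k] H)) :
    LinearMap.trace k _ (tensorHit F) = F (h ⊗ₜ[k] h) := by
  obtain ⟨T, rfl⟩ := (TensorProduct.dualDistribEquiv k H H).surjective F
  change LinearMap.trace k _ (tensorHit (TensorProduct.dualDistrib k H H T)) =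
    TensorProduct.dualDistrib k H H T (h ⊗ₜ[k] h)
  induction T with
  | zero =>
    rw [map_zero, show tensorHit (0 : Dual k (H ⊗[k] H)) = 0 by ext; simp [tensorHit_tmul]]
    simp
  | tmul f g =>
    rw [tensorHit_dualDistrib, LinearMap.trace_tensorProduct', ← hh, ← hh,
      TensorProduct.dualDistrib_apply]
  | add x y hx hy => rw [map_add, tensorHit_add, map_add, hx, hy, LinearMap.add_apply]

/-- The regular character is a scalar multiple of an idempotent. -/
lemma regularCharacter_mul_self : h * h = (finrank k H : k) • h := by
  rw [← sub_eq_zero, ← Module.forall_dual_apply_eq_zero_iff k]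
  intro f
  rw [map_sub, sub_eq_zero, map_smul, hh f]
  have h1 := trace_tensorHit hh (f ∘ₗ LinearMap.mul' k H)
  rw [LinearMap.comp_apply, LinearMap.mul'_apply] at h1
  have h2 : galoisMap k H ∘ₗ galoisInv k H = LinearMap.id :=
    mul_eq_one_comm.1 galoisInv_comp_galoisMap
  have h3 : tensorHit (f ∘ₗ LinearMap.mul' k H) =
      galoisInv k H ∘ₗ ((rightHit f).lTensor H ∘ₗ galoisMap k H) := by
    rw [← galoisMap_comp_tensorHit, ← LinearMap.comp_assoc, galoisInv_comp_galoisMap,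
      LinearMap.id_comp]
  rw [← h1, h3, LinearMap.trace_comp_comm', LinearMap.comp_assoc, h2, LinearMap.comp_id,
    LinearMap.lTensor, LinearMap.trace_tensorProduct', LinearMap.trace_id, smul_eq_mul]

/-- S² is a coalgebra automorphism, so twisting `f` by it conjugates `rightHit f` and preserves the
trace. -/
lemma antipode_antipode_regularCharacter (hS : Function.Bijective (antipode k (A := H))) :
    antipode k (antipode k h) = h := by
  rw [← sub_eq_zero, ← Module.forall_dual_apply_eq_zero_iff k]
  intro f
  let σ : H ≃ₗ[k] H := (LinearEquiv.ofBijective (antipode k (A := H)) hS).trans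
    (LinearEquiv.ofBijective (antipode k (A := H)) hS)
  have hσ (x) : σ x = antipode k (antipode k x) := rfl
  have hcomul (x : H) : comul (R := k) (σ x) =
      TensorProduct.map σ.toLinearMap σ.toLinearMap (comul (R := k) x) := by
    rw [hσ, comul_antipode, comul_antipode]
    generalize comul (R := k) x = T
    induction T with
    | zero => simp
    | tmul a b => simp [hσ]
    | add x y hx hy => simp only [map_add, hx, hy]
  have h1 : rightHit f = σ.conj (rightHit (f ∘ₗ σ.toLinearMap)) := by
    refine LinearMap.ext fun y => ?_
    obtain ⟨x, rfl⟩ := σ.surjective y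
    rw [LinearEquiv.conj_apply_apply, LinearEquiv.symm_apply_apply, rightHit_apply, hcomul,
      rightHit_apply]
    generalize comul (R := k) x = T
    induction T with
    | zero => simp
    | tmul a b => simp
    | add x y hx hy => simp only [map_add, contractSnd_add, hx, hy]
  rw [map_sub, sub_eq_zero, hh f, h1, LinearMap.trace_conj', ← hh]
  rfl

end RegularCharacter

lemma trace_eq_finrank_range_of_isIdempotentElem {V : Type*} [AddCommGroup V] [Module k V]
    [FiniteDimensional k V] {e : V →ₗ[k] V} (he : IsIdempotentElem e) :
    LinearMap.trace k V e = (finrank k (LinearMap.range e) : k) :=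
  (LinearMap.IsIdempotentElem.isProj_range e he).trace

namespace IsNormalizedIntegral

variable {Λ : H} (hΛ : IsNormalizedIntegral k Λ)
include hΛ

/-- Otherwise S⁻² has trace zero, so all its composites with right multiplications do too, against
the value λ(S(Λ)) = 1 at Λ. -/
lemma cointegral_one_ne_zero [IsAlgClosed k] [CharZero k] [IsSemisimpleRing H] :
    hΛ.cointegral 1 ≠ 0 := by
  intro h0
  have := hΛ.finite_and_bijective.1
  obtain ⟨m, hm, hσm⟩ := hΛ.exists_antipodeSq_pow_eq_one
  -- With (S²)ᵐ = 1, the power m − 1 serves as S⁻².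
  have hτ (y : H) : antipode k (antipode k ((antipodeSq k H ^ (m - 1)).toLinearMap y)) = y := by
    have h1 : antipodeSq k H * antipodeSq k H ^ (m - 1) = 1 := by
      rw [mul_pow_sub_one hm.ne', hσm]
    exact congr($h1 y)
  have hτm : (antipodeSq k H ^ (m - 1)) ^ m = 1 := by
    rw [← pow_mul, mul_comm, pow_mul, hσm, one_pow]
  have h1 := hΛ.trace_mulRight_comp _ hτ
  have h2 := trace_mulRight_comp_eq_zero hm _ hτm (by
    have := h1 1
    rwa [LinearMap.mulRight_one, LinearMap.id_comp, antipode_one, h0] at this)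
  have h3 := h1 Λ
  rw [h2, hΛ.antipode_eq, hΛ.cointegral_apply] at h3
  exact zero_ne_one h3

/-- **Larson–Radford**: the antipode of a semisimple Hopf algebra over an algebraically closed field
of characteristic zero is an involution. -/
theorem antipode_antipode [IsAlgClosed k] [CharZero k] [IsSemisimpleRing H] (x : H) :
    antipode k (antipode k x) = x := by
  have := hΛ.finite_and_bijective.1
  have hD := hΛ.cointegral_one_ne_zero
  -- At x = 1 the identity x₁λ(x₂) = λ(x)g reads λ(1)1 = λ(1)g.
  have hg : hΛ.distinguished = 1 := by
    have h1 := hΛ.rightHit_cointegral 1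
    rw [rightHit_apply, Bialgebra.comul_one, Algebra.TensorProduct.one_def, contractSnd_tmul] at h1
    exact (smul_right_injective H hD h1).symm
  let σ : H →ₗ[k] H := (antipodeSq k H).toLinearMap
  have hσσ (y : H) : σ (σ y) = y := by
    have := hΛ.antipode_pow_four_mul y
    rwa [hg, mul_one, one_mul] at this
  have hσmul (a b : H) : σ (a * b) = σ a * σ b := map_mul (antipodeSq k H) a b
  have htr (x : H) : LinearMap.trace k H (LinearMap.mulRight k x ∘ₗ σ) = hΛ.cointegral x := by
    rw [hΛ.trace_mulRight_comp σ hσσ, hΛ.cointegral_antipode, hg, one_mul]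
  obtain ⟨h, hh⟩ := exists_apply_eq_trace_rightHit k H
  have hnt : Nontrivial H := by
    refine ⟨Λ, 0, fun h => ?_⟩
    have := hΛ.counit_eq
    rw [h, map_zero] at this
    exact zero_ne_one this
  have hn : 0 < finrank k H := finrank_pos
  set n := finrank k H with hndef
  have hn0 : (n : k) ≠ 0 := by exact_mod_cast hn.ne'
  let e := (n : k)⁻¹ • h
  have hee : e * e = e := by
    simp only [e]
    rw [smul_mul_smul_comm, regularCharacter_mul_self hh, smul_smul, mul_assoc,
      inv_mul_cancel₀ hn0, mul_one]
  have hσe : σ e = e := by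
    simp only [e, map_smul]
    congr 1
    exact antipode_antipode_regularCharacter hh hΛ.antipode_bijective
  have hlamh : hΛ.cointegral h = hΛ.cointegral 1 := by
    rw [hh, show rightHit hΛ.cointegral = hΛ.cointegral.smulRight 1 by
      refine LinearMap.ext fun x => ?_
      rw [hΛ.rightHit_cointegral, hg, LinearMap.smulRight_apply], LinearMap.trace_smulRight]
  have hlame : (n : k) * hΛ.cointegral e = hΛ.cointegral 1 := by
    simp only [e, map_smul, smul_eq_mul]
    rw [hlamh, mul_inv_cancel_left₀ hn0]
  have h2 : (2 : k) ≠ 0 := two_ne_zero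
  have h22 : (2⁻¹ : k) + 2⁻¹ = 1 := by rw [← two_mul, mul_inv_cancel₀ h2]
  -- The projection onto the fixed space of σ = S². It commutes with right multiplication by `e`,
  -- since σ fixes `e`.
  let Q : H →ₗ[k] H := (2⁻¹ : k) • (LinearMap.id + σ)
  have hQ (y) : Q y = (2⁻¹ : k) • (y + σ y) := rfl
  have hQσ (y) : σ (Q y) = Q y := by rw [hQ, map_smul, map_add, hσσ, add_comm]
  have hQQ (y) : Q (Q y) = Q y := by
    rw [hQ (Q y), hQσ, smul_add, ← add_smul, h22, one_smul]
  let R : H →ₗ[k] H := LinearMap.mulRight k e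
  have hRQ (y) : R (Q y) = Q (R y) := by
    simp only [R, LinearMap.mulRight_apply, hQ, hσmul, hσe, smul_mul_assoc, add_mul]
  have hRR (y) : R (R y) = R y := by
    simp only [R, LinearMap.mulRight_apply, mul_assoc, hee]
  have hQi : IsIdempotentElem Q := LinearMap.ext hQQ
  have hRi : IsIdempotentElem R := LinearMap.ext hRR
  have hRQi : IsIdempotentElem (R ∘ₗ Q) := LinearMap.ext fun y => by
    change R (Q (R (Q y))) = R (Q y)
    rw [← hRQ, hRR, hQQ]
  have t1 := trace_eq_finrank_range_of_isIdempotentElem hQi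
  have t2 := trace_eq_finrank_range_of_isIdempotentElem hRi
  have t3 := trace_eq_finrank_range_of_isIdempotentElem hRQi
  have s1 : LinearMap.trace k H Q = 2⁻¹ * (n + hΛ.cointegral 1) := by
    have := htr 1
    rw [LinearMap.mulRight_one, LinearMap.id_comp] at this
    simp only [Q]
    rw [map_smul, map_add, LinearMap.trace_id, this, smul_eq_mul]
  have s3 : LinearMap.trace k H (R ∘ₗ Q) = 2⁻¹ * (LinearMap.trace k H R + hΛ.cointegral e) := by
    rw [← htr e, ← map_add, ← smul_eq_mul, ← map_smul]
    congr 1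
    refine LinearMap.ext fun y => ?_
    change R (Q y) = (2⁻¹ : k) • (R y + R (σ y))
    rw [hQ, map_smul, map_add]
  set r₀ := finrank k (LinearMap.range Q)
  set r₁ := finrank k (LinearMap.range R)
  set r₂ := finrank k (LinearMap.range (R ∘ₗ Q))
  have hr₀ : r₀ ≤ n := Submodule.finrank_le _
  -- Traces of idempotents are ranks, so λ(e) is an integer z. As λ(1) = nλ(e), the rank of Q
  -- satisfies 2r₀ = n(1 + z); then 0 ≤ r₀ ≤ n and z ≠ 0 leave z = ±1, and Q(1) = 1 excludes −1.
  have hz : hΛ.cointegral e = ((2 * r₂ - r₁ : ℤ) : k) := by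
    rw [t3, t2] at s3
    push_cast
    rw [s3]
    field_simp
    ring
  have hz0 : (2 * r₂ - r₁ : ℤ) ≠ 0 := by
    intro h
    rw [h, Int.cast_zero] at hz
    rw [hz, mul_zero] at hlame
    exact hD hlame.symm
  have heq : (2 * r₀ : ℤ) = n * (1 + (2 * r₂ - r₁)) := by
    have : ((2 * r₀ : ℤ) : k) = ((n * (1 + (2 * r₂ - r₁)) : ℤ) : k) := by
      rw [t1, ← hlame, hz] at s1
      push_cast at s1 ⊢
      rw [s1]
      field_simp
    exact_mod_cast this
  generalize (2 * r₂ - r₁ : ℤ) = z at hz0 heq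
  have hz1 : -1 ≤ z := by
    by_contra hlt
    have : (n : ℤ) * (1 + z) < 0 := mul_neg_of_pos_of_neg (by exact_mod_cast hn) (by lia)
    lia
  have hz2 : z ≤ 1 := by
    by_contra hlt
    have : (n : ℤ) * 3 ≤ n * (1 + z) := mul_le_mul_of_nonneg_left (by lia) (by lia)
    lia
  have hz3 : z = -1 ∨ z = 1 := by lia
  rcases hz3 with rfl | rfl
  · exfalso
    have hr : r₀ = 0 := by lia
    have hQ0 : LinearMap.range Q = ⊥ := Submodule.finrank_eq_zero.1 hr
    have h1 := congr($(LinearMap.range_eq_bot.1 hQ0) 1)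
    have h3 : σ 1 = 1 := map_one (antipodeSq k H)
    rw [hQ, h3, smul_add, ← add_smul, h22, one_smul] at h1
    exact one_ne_zero h1
  · have hr : r₀ = n := by lia
    have hQ0 : LinearMap.range Q = ⊤ := Submodule.eq_top_of_finrank_eq hr
    obtain ⟨y, hy⟩ := LinearMap.range_eq_top.1 hQ0 x
    have h1 := hQσ y
    rw [hy] at h1
    exact h1

end IsNormalizedIntegral

end HopfAlgebra

end

/-! ### Coefficient matrices and invariance of the regular trace -/

noncomputable section

open Module

section BasisExpansion

variable {k : Type*} [Field k] {M N P : Type*} [AddCommGroup M] [Module k M] [AddCommGroup N]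
  [Module k N] [AddCommGroup P] [Module k P] {ι : Type*} [Fintype ι]

lemma eq_sum_tmul_contractFst (b : Basis ι k M) (T : M ⊗[k] N) :
    T = ∑ i, b i ⊗ₜ[k] contractFst T (b.coord i) := by
  induction T with
  | zero => simp
  | tmul m n =>
    simp_rw [contractFst_tmul, ← TensorProduct.smul_tmul, ← TensorProduct.sum_tmul,
      Basis.coord_apply, b.sum_repr]
  | add x y hx hy =>
    simp_rw [contractFst_add, TensorProduct.tmul_add, Finset.sum_add_distrib]
    rw [← hx, ← hy]

lemma sum_basis_tmul_inj (b : Basis ι k M) {f g : ι → N} :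
    ∑ i, b i ⊗ₜ[k] f i = ∑ i, b i ⊗ₜ[k] g i ↔ f = g := by
  classical
  refine ⟨fun h => funext fun j => ?_, fun h => h ▸ rfl⟩
  have h' := congr(contractFst $h (b.coord j))
  simpa [contractFst_sum, Finsupp.single_apply, ite_smul] using h'

lemma sum_tmul_basis_inj (b : Basis ι k M) {f g : ι → N} :
    ∑ i, f i ⊗ₜ[k] b i = ∑ i, g i ⊗ₜ[k] b i ↔ f = g := by
  rw [← sum_basis_tmul_inj b, ← (TensorProduct.comm k N M).injective.eq_iff]
  simp

lemma eq_sum_sum_smul_tmul (b : Basis ι k M) (x : M ⊗[k] M) :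
    x = ∑ i, ∑ j, (b.tensorProduct b).repr x (i, j) • b i ⊗ₜ[k] b j := by
  conv_lhs => rw [← (b.tensorProduct b).sum_repr x, Fintype.sum_prod_type]
  simp

end BasisExpansion

section CoactionMatrix

open Matrix

variable {k H K ι : Type*} [Field k] [Ring H] [Algebra k H] [Ring K] [Algebra k K] [Fintype ι]
  (b : Basis ι k K)

/-- The matrix `R` with `ρ(bⱼ) = ∑ᵢ bᵢ ⊗ Rᵢⱼ`. -/
def coactMatrix (ρ : K →ₗ[k] K ⊗[k] H) : Matrix ι ι H :=
  Matrix.of fun i j => contractFst (ρ (b j)) (b.coord i)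

lemma apply_basis_eq_sum (ρ : K →ₗ[k] K ⊗[k] H) (j : ι) :
    ρ (b j) = ∑ i, b i ⊗ₜ[k] coactMatrix b ρ i j :=
  eq_sum_tmul_contractFst b _

/-- The coefficient matrix of an element of `K ⊗ K`, with entries viewed in `H`. -/
def tensorMatrix (H : Type*) [Ring H] [Algebra k H] (x : K ⊗[k] K) : Matrix ι ι H :=
  Matrix.of fun i j => algebraMap k H ((b.tensorProduct b).repr x (i, j))

section Trace

variable [DecidableEq ι] (ρ : K →ₐ[k] K ⊗[k] H) {R' : Matrix ι ι H}

/-- A coaction with suitably invertible coefficient matrix preserves the trace of the regular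
representation. -/
lemma contractFst_coact_trace (t : Dual k K)
    (ht : ∀ x, t x = LinearMap.trace k K (LinearMap.mulLeft k x))
    (h1 : coactMatrix b ρ.toLinearMap * R' = 1)
    (h2 : (coactMatrix b ρ.toLinearMap)ᵀ * R'ᵀ = 1) (x : K) :
    contractFst (ρ x) t = t x • (1 : H) := by
  set R := coactMatrix b ρ.toLinearMap with hR
  have hρ (j) : ρ (b j) = ∑ i, b i ⊗ₜ[k] R i j := apply_basis_eq_sum b ρ.toLinearMap j
  let M (j c a : ι) : k := b.repr (b j * b a) c
  have hM (j a) : b j * b a = ∑ c, M j c a • b c := (b.sum_repr _).symm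
  have htM (j) : t (b j) = ∑ a, M j a a := by
    rw [ht, LinearMap.trace_eq_matrix_trace k b, Matrix.trace]
    simp only [Matrix.diag_apply, LinearMap.toMatrix_apply, LinearMap.mulLeft_apply, M]
  let N (j : ι) : Matrix ι ι H := Matrix.of fun c d => ∑ i, M i c d • R i j
  let M' (j : ι) : Matrix ι ι H := Matrix.of fun c d => algebraMap k H (M j c d)
  -- `N j` is the matrix over `H` of left multiplication by ρ(bⱼ); the identity is multiplicativity
  -- of ρ in coordinates.
  have hNR (j) : N j * R = R * M' j := by
    ext c a
    have h3 : ρ (b j) * ρ (b a) = ρ (b j * b a) := (map_mul ρ _ _).symm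
    rw [hM, map_sum] at h3
    simp_rw [map_smul, hρ, Finset.sum_mul_sum, Algebra.TensorProduct.tmul_mul_tmul, hM,
      TensorProduct.sum_tmul, TensorProduct.smul_tmul, Finset.smul_sum,
      ← TensorProduct.tmul_smul] at h3
    have h4 := congr(contractFst $h3 (b.coord c))
    simp only [contractFst_sum, contractFst_tmul, Basis.coord_apply, Basis.repr_self,
      Finsupp.single_apply, ite_smul, one_smul, zero_smul, Finset.sum_ite_eq',
      Finset.mem_univ, if_true] at h4
    simp only [Matrix.mul_apply, N, M', Matrix.of_apply, Finset.sum_mul]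
    rw [Finset.sum_comm]
    simp_rw [smul_mul_assoc]
    rw [h4]
    exact Finset.sum_congr rfl fun e _ => by rw [Algebra.smul_def, Algebra.commutes]
  have hN (j) : N j = R * M' j * R' := by
    rw [← hNR, Matrix.mul_assoc, h1, Matrix.mul_one]
  have key (j) : ∑ i, t (b i) • R i j = t (b j) • (1 : H) := by
    calc ∑ i, t (b i) • R i j = (N j).trace := by
          simp only [Matrix.trace, Matrix.diag_apply, N, Matrix.of_apply, htM, Finset.sum_smul]
          rw [Finset.sum_comm]
      -- Over noncommutative `H` the trace is not cyclic. Only the scalar entries of `M' j` can be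
      -- moved, which leaves Rᵀ R'ᵀ and not R' R.
      _ = ∑ e, ∑ a, M j e a • (Rᵀ * R'ᵀ) e a := by
          rw [hN]
          simp only [Matrix.trace, Matrix.diag_apply, Matrix.mul_apply, Finset.sum_mul,
            Matrix.transpose_apply, Finset.smul_sum, M', Matrix.of_apply]
          rw [Finset.sum_comm]
          conv_rhs => rw [Finset.sum_comm]
          refine Finset.sum_congr rfl fun a _ => ?_
          rw [Finset.sum_comm]
          refine Finset.sum_congr rfl fun e _ => Finset.sum_congr rfl fun c _ => ?_
          rw [← Algebra.commutes, mul_assoc, ← Algebra.smul_def]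
      _ = t (b j) • (1 : H) := by
          rw [h2, htM, Finset.sum_smul]
          simp [Matrix.one_apply]
  have h5 : sliceFst H t ∘ₗ ρ.toLinearMap = t.smulRight 1 := by
    refine b.ext fun j => ?_
    change contractFst (ρ (b j)) t = t (b j) • (1 : H)
    rw [hρ, contractFst_sum, ← key]
    simp
  exact congr($h5 x)

/-- The symmetric separability idempotent is dual to the trace form of the regular
representation. -/
lemma IsSymmSepIdempotent.exists_trace {p : K ⊗[k] K} (hp : IsSymmSepIdempotent k p) :
    FiniteDimensional k K ∧ ∃ t : Dual k K,
      (∀ x, t x = LinearMap.trace k K (LinearMap.mulLeft k x)) ∧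
      ∀ x, contractFst p (t ∘ₗ LinearMap.mulLeft k x) = x := by
  have hinv (a : K) :
      (LinearMap.mulLeft k a).lTensor K p = (LinearMap.mulRight k a).rTensor K p := by
    have h := congr(TensorProduct.comm k K K $(hp.invariant a))
    have h1 (T : K ⊗[k] K) : TensorProduct.comm k K K ((LinearMap.mulLeft k a).rTensor K T) =
        (LinearMap.mulLeft k a).lTensor K (TensorProduct.comm k K K T) := by
      induction T with
      | zero => simp
      | tmul m n => simp
      | add x y hx hy => simp only [map_add, hx, hy]
    have h2 (T : K ⊗[k] K) : TensorProduct.comm k K K ((LinearMap.mulRight k a).lTensor K T) =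
        (LinearMap.mulRight k a).rTensor K (TensorProduct.comm k K K T) := by
      induction T with
      | zero => simp
      | tmul m n => simp
      | add x y hx hy => simp only [map_add, hx, hy]
    rwa [h1, h2, hp.symmetric] at h
  obtain ⟨hfd, hbij⟩ := finite_and_bijective_contractFst p (fun a => ⟨_, hinv a⟩) LinearMap.id
    (by rw [LinearMap.rTensor_id, LinearMap.id_apply, hp.normalized])
  refine ⟨hfd, ?_⟩
  obtain ⟨t, ht⟩ := hbij.2 1
  have hx (x) : contractFst p (t ∘ₗ LinearMap.mulLeft k x) = x := by
    rw [← contractFst_rTensor, hp.invariant, contractFst_lTensor, ht, LinearMap.mulRight_apply,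
      one_mul]
  refine ⟨t, fun x => ?_, hx⟩
  let Ψ : K →ₗ[k] Dual k K := LinearMap.compRight k t ∘ₗ LinearMap.mul k K
  -- From xy = t(yp¹)xp², the trace of left multiplication by x is t(xp²p¹), which is t(x) by
  -- symmetry and normalization.
  have h1 : LinearMap.mulLeft k x = contractFst ((LinearMap.mulLeft k x).lTensor K p) ∘ₗ Ψ := by
    refine LinearMap.ext fun y => ?_
    change x * y = contractFst ((LinearMap.mulLeft k x).lTensor K p) (Ψ y)
    rw [contractFst_lTensor]
    exact congr(x * $(hx y)).symm
  have h2 (T : K ⊗[k] K) : TensorProduct.lift Ψ.flip ((LinearMap.mulLeft k x).lTensor K T) =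
      t (x * LinearMap.mul' k K (TensorProduct.comm k K K T)) := by
    induction T with
    | zero => simp
    | tmul a b => simp [Ψ, mul_assoc]
    | add x y hx hy => simp [hx, hy, mul_add]
  rw [h1, trace_contractFst, h2, hp.symmetric, hp.normalized, mul_one]

/-- The coefficient matrix of the symmetric separability idempotent is coinvariant. -/
lemma IsSymmSepIdempotent.coactMatrix_mul_tensorMatrix {p : K ⊗[k] K}
    (hp : IsSymmSepIdempotent k p)
    (h1 : coactMatrix b ρ.toLinearMap * R' = 1)
    (h2 : (coactMatrix b ρ.toLinearMap)ᵀ * R'ᵀ = 1)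
    (h3 : R'ᵀ * (coactMatrix b ρ.toLinearMap)ᵀ = 1) :
    coactMatrix b ρ.toLinearMap * tensorMatrix b H p * (coactMatrix b ρ.toLinearMap)ᵀ =
      tensorMatrix b H p := by
  obtain ⟨-, t, ht, htp⟩ := hp.exists_trace
  have htρ := contractFst_coact_trace b ρ t ht h1 h2
  set R := coactMatrix b ρ.toLinearMap with hR
  have hρ (j) : ρ (b j) = ∑ i, b i ⊗ₜ[k] R i j := apply_basis_eq_sum b ρ.toLinearMap j
  let G₀ : Matrix ι ι k := Matrix.of fun i j => t (b i * b j)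
  let P₀ : Matrix ι ι k := Matrix.of fun i j => (b.tensorProduct b).repr p (i, j)
  let G : Matrix ι ι H := G₀.map (algebraMap k H)
  have hP : tensorMatrix b H p = P₀.map (algebraMap k H) := rfl
  -- The reproducing identity t(xp¹)p² = x says that P₀ inverts the Gram matrix.
  have hGP₀ : G₀ * P₀ = 1 := by
    ext a j
    have h := htp (b a)
    rw [eq_sum_sum_smul_tmul b p] at h
    have h' := congr(b.coord j $h)
    simp only [contractFst_sum, contractFst_smul, contractFst_tmul, map_sum, map_smul,
      Basis.coord_apply, Basis.repr_self, Finsupp.single_apply, LinearMap.comp_apply,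
      LinearMap.mulLeft_apply, smul_eq_mul, mul_ite, mul_one, mul_zero, Finset.sum_ite_eq',
      Finset.mem_univ, if_true] at h'
    rw [Matrix.one_apply, ← h', Matrix.mul_apply]
    exact Finset.sum_congr rfl fun i _ => mul_comm _ _
  have hGP : G * tensorMatrix b H p = 1 := by
    rw [hP, ← Matrix.map_mul, hGP₀, Matrix.map_one _ (map_zero _) (map_one _)]
  have hPG : tensorMatrix b H p * G = 1 := by
    rw [hP, ← Matrix.map_mul, mul_eq_one_comm.1 hGP₀, Matrix.map_one _ (map_zero _) (map_one _)]
  have hRGR : Rᵀ * G * R = G := by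
    ext i j
    have h := htρ (b i * b j)
    rw [map_mul, hρ, hρ, Finset.sum_mul_sum] at h
    simp only [Algebra.TensorProduct.tmul_mul_tmul, contractFst_sum, contractFst_tmul] at h
    simp only [Matrix.mul_apply, Matrix.transpose_apply, G, G₀, Matrix.map_apply, Matrix.of_apply,
      Finset.sum_mul]
    rw [Algebra.algebraMap_eq_smul_one, ← h, Finset.sum_comm]
    refine Finset.sum_congr rfl fun l _ => Finset.sum_congr rfl fun m _ => ?_
    rw [← Algebra.commutes, mul_assoc, ← Algebra.smul_def]
  have hGR : G * R = R'ᵀ * G := by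
    rw [← hRGR, ← Matrix.mul_assoc, ← Matrix.mul_assoc, h3, Matrix.one_mul, hRGR]
  calc R * tensorMatrix b H p * Rᵀ
      = tensorMatrix b H p * (G * R) * tensorMatrix b H p * Rᵀ := by
        rw [← Matrix.mul_assoc _ G, hPG, Matrix.one_mul]
    _ = tensorMatrix b H p * R'ᵀ * (G * tensorMatrix b H p) * Rᵀ := by
        rw [hGR]; simp only [Matrix.mul_assoc]
    _ = tensorMatrix b H p := by
        rw [hGP, Matrix.mul_one, Matrix.mul_assoc, h3, Matrix.mul_one]

end Trace

end CoactionMatrix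

end

/-! ### The two conditions as matrix identities -/

noncomputable section

open Module Matrix

section AntipodeMatrix

open HopfAlgebra Coalgebra

variable {k H ι : Type*} [Field k] [Ring H] [HopfAlgebra k H] [Fintype ι] [DecidableEq ι]
  {R : Matrix ι ι H}

lemma antipode_matrix_mul (hε : ∀ i j, counit (R := k) (R i j) = if i = j then 1 else 0)
    (hΔ : ∀ i j, comul (R := k) (R i j) = ∑ l, R i l ⊗ₜ[k] R l j) :
    R.map (antipode k) * R = 1 := by
  ext i j
  have h := mul_antipode_rTensor_comul_apply (R := k) (R i j)
  rw [hΔ, hε, map_sum, map_sum] at h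
  simp only [LinearMap.rTensor_tmul, LinearMap.mul'_apply] at h
  rw [Matrix.mul_apply, Matrix.one_apply]
  refine h.trans ?_
  split_ifs <;> simp

lemma mul_antipode_matrix (hε : ∀ i j, counit (R := k) (R i j) = if i = j then 1 else 0)
    (hΔ : ∀ i j, comul (R := k) (R i j) = ∑ l, R i l ⊗ₜ[k] R l j) :
    R * R.map (antipode k) = 1 := by
  ext i j
  have h := mul_antipode_lTensor_comul_apply (R := k) (R i j)
  rw [hΔ, hε, map_sum, map_sum] at h
  simp only [LinearMap.lTensor_tmul, LinearMap.mul'_apply] at h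
  rw [Matrix.mul_apply, Matrix.one_apply]
  refine h.trans ?_
  split_ifs <;> simp

/-- Transposing a product over `H` is not formal: S reverses each product of entries, and S² = 1
restores the entries. -/
lemma transpose_mul_antipode_transpose (hS : ∀ x : H, antipode k (antipode k x) = x)
    (h : R * R.map (antipode k) = 1) : Rᵀ * (R.map (antipode k))ᵀ = 1 := by
  ext i j
  have h' := congr(antipode k ($h j i))
  rw [Matrix.mul_apply, map_sum] at h'
  simp only [Matrix.map_apply, antipode_mul_antidistrib, hS] at h'
  rw [Matrix.mul_apply]
  refine h'.trans ?_
  rw [Matrix.one_apply, Matrix.one_apply, apply_ite (antipode k), antipode_one, map_zero]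
  simp only [eq_comm]

lemma antipode_transpose_mul_transpose (hS : ∀ x : H, antipode k (antipode k x) = x)
    (h : R.map (antipode k) * R = 1) : (R.map (antipode k))ᵀ * Rᵀ = 1 := by
  ext i j
  have h' := congr(antipode k ($h j i))
  rw [Matrix.mul_apply, map_sum] at h'
  simp only [Matrix.map_apply, antipode_mul_antidistrib, hS] at h'
  rw [Matrix.mul_apply]
  refine h'.trans ?_
  rw [Matrix.one_apply, Matrix.one_apply, apply_ite (antipode k), antipode_one, map_zero]
  simp only [eq_comm]

end AntipodeMatrix

section CyclicMatrix

variable {k H K ι : Type*} [Field k] [Ring H] [Algebra k H] [Ring K] [Algebra k K] [Fintype ι]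
  (b : Basis ι k K)

lemma sum_sum_smul_mul_eq (R : Matrix ι ι H) (x : K ⊗[k] K) (m l : ι) :
    ∑ i, ∑ j, (b.tensorProduct b).repr x (i, j) • (R m i * R l j) =
      (R * tensorMatrix b H x * Rᵀ) m l := by
  simp only [Matrix.mul_apply, tensorMatrix, Matrix.of_apply, Matrix.transpose_apply,
    Finset.sum_mul]
  rw [Finset.sum_comm]
  refine Finset.sum_congr rfl fun j _ => Finset.sum_congr rfl fun i _ => ?_
  rw [← Algebra.commutes, mul_assoc, ← Algebra.smul_def]

/-- Comparison of coefficients, with `g` left general so that it serves right and left coactions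
alike. -/
lemma assoc_rTensor_eq_lTensor_iff (ρ : K →ₗ[k] K ⊗[k] H) (g : K →ₗ[k] H ⊗[k] K)
    (R' : Matrix ι ι H) (hg : ∀ j, g (b j) = ∑ l, R' l j ⊗ₜ[k] b l) (x : K ⊗[k] K) :
    TensorProduct.assoc k K H K (LinearMap.rTensor K ρ x) = LinearMap.lTensor K g x ↔
      coactMatrix b ρ * tensorMatrix b H x = tensorMatrix b H x * R'ᵀ := by
  have h1 : TensorProduct.assoc k K H K (LinearMap.rTensor K ρ x) =
      ∑ m, b m ⊗ₜ[k] ∑ j, (coactMatrix b ρ * tensorMatrix b H x) m j ⊗ₜ[k] b j := by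
    conv_lhs => rw [eq_sum_sum_smul_tmul b x]
    simp only [map_sum, map_smul, LinearMap.rTensor_tmul, apply_basis_eq_sum b ρ,
      TensorProduct.sum_tmul, TensorProduct.assoc_tmul, Finset.smul_sum]
    refine ((Finset.sum_congr rfl fun i _ => Finset.sum_comm).trans Finset.sum_comm).trans ?_
    refine Finset.sum_congr rfl fun m _ => ?_
    rw [Finset.sum_comm, TensorProduct.tmul_sum]
    refine Finset.sum_congr rfl fun j _ => ?_
    simp only [Matrix.mul_apply, tensorMatrix, Matrix.of_apply, TensorProduct.sum_tmul,
      TensorProduct.tmul_sum]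
    refine Finset.sum_congr rfl fun i _ => ?_
    rw [← Algebra.commutes, ← Algebra.smul_def, ← TensorProduct.smul_tmul', TensorProduct.tmul_smul]
  have h2 : LinearMap.lTensor K g x =
      ∑ m, b m ⊗ₜ[k] ∑ l, (tensorMatrix b H x * R'ᵀ) m l ⊗ₜ[k] b l := by
    conv_lhs => rw [eq_sum_sum_smul_tmul b x]
    simp only [map_sum, map_smul, LinearMap.lTensor_tmul, hg]
    refine Finset.sum_congr rfl fun m _ => ?_
    simp only [← TensorProduct.tmul_smul, ← TensorProduct.tmul_sum]
    congr 1
    simp only [Finset.smul_sum]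
    rw [Finset.sum_comm]
    refine Finset.sum_congr rfl fun l _ => ?_
    simp only [Matrix.mul_apply, tensorMatrix, Matrix.of_apply, TensorProduct.sum_tmul,
      Matrix.transpose_apply]
    refine Finset.sum_congr rfl fun j _ => ?_
    rw [← Algebra.smul_def, ← TensorProduct.smul_tmul']
  rw [h1, h2, sum_basis_tmul_inj]
  refine ⟨fun h => Matrix.ext fun i j => ?_, fun h => by rw [h]⟩
  exact congr_fun ((sum_tmul_basis_inj b).1 (congr_fun h i)) j

variable [DecidableEq ι]

lemma mul_mul_transpose_eq_iff {R R' : Matrix ι ι H} (h1 : Rᵀ * R'ᵀ = 1) (h2 : R'ᵀ * Rᵀ = 1)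
    (P : Matrix ι ι H) : R * P * Rᵀ = P ↔ R * P = P * R'ᵀ := by
  constructor <;> intro h
  · rw [← Matrix.mul_one (R * P), ← h1, ← Matrix.mul_assoc, h]
  · rw [h, Matrix.mul_assoc, h2, Matrix.mul_one]

end CyclicMatrix

namespace RightComoduleAlgebra

open HopfAlgebra Coalgebra

variable {k H K ι : Type*} [Field k] [Ring H] [HopfAlgebra k H] [Ring K] [Algebra k K]
  (ρ : RightComoduleAlgebra k H K) [Fintype ι] (b : Basis ι k K)

/-- The coefficient matrix of the coaction. -/
abbrev matrix : Matrix ι ι H := coactMatrix b ρ.coact.toLinearMap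

lemma coact_basis (j : ι) : ρ.coact (b j) = ∑ i, b i ⊗ₜ[k] ρ.matrix b i j :=
  apply_basis_eq_sum b ρ.coact.toLinearMap j

lemma comul_matrix (i j : ι) :
    comul (R := k) (ρ.matrix b i j) = ∑ l, ρ.matrix b i l ⊗ₜ[k] ρ.matrix b l j := by
  have h := congr($(ρ.coassoc) (b j))
  simp only [LinearMap.comp_apply, AlgHom.toLinearMap_apply, coact_basis ρ b, map_sum,
    LinearMap.rTensor_tmul, LinearMap.lTensor_tmul, TensorProduct.sum_tmul,
    LinearEquiv.coe_coe, TensorProduct.assoc_tmul] at h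
  rw [Finset.sum_comm] at h
  simp only [← TensorProduct.tmul_sum] at h
  exact congr_fun ((sum_basis_tmul_inj b).1 h.symm) i

lemma counit_matrix [DecidableEq ι] (i j : ι) :
    counit (R := k) (ρ.matrix b i j) = if i = j then 1 else 0 := by
  have h := congr(b.repr ($(ρ.counit_coact) (b j)) i)
  simp only [LinearMap.comp_apply, AlgHom.toLinearMap_apply, coact_basis ρ b, map_sum,
    LinearMap.lTensor_tmul, LinearEquiv.coe_coe, TensorProduct.rid_tmul, map_smul,
    Basis.repr_self, LinearMap.id_apply, Finsupp.coe_finsetSum, Finset.sum_apply,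
    Finsupp.smul_apply, Finsupp.single_apply, smul_eq_mul, mul_ite, mul_one, mul_zero,
    Finset.sum_ite_eq', Finset.mem_univ, if_true] at h
  rw [h]
  simp only [eq_comm]

lemma isCoinvariant_iff (x : K ⊗[k] K) : ρ.IsCoinvariant x ↔
    ρ.matrix b * tensorMatrix b H x * (ρ.matrix b)ᵀ = tensorMatrix b H x := by
  have h1 : ρ.envCoact x = ∑ q : ι × ι, b.tensorProduct b q ⊗ₜ[k]
      (ρ.matrix b * tensorMatrix b H x * (ρ.matrix b)ᵀ) q.1 q.2 := by
    have h0 (i j) : ρ.envCoact (b i ⊗ₜ[k] b j) = ∑ q : ι × ι, b.tensorProduct b q ⊗ₜ[k]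
        (ρ.matrix b q.1 i * ρ.matrix b q.2 j) := by
      simp only [envCoact, LinearMap.comp_apply, TensorProduct.map_tmul,
        AlgHom.toLinearMap_apply, coact_basis ρ b, TensorProduct.sum_tmul, TensorProduct.tmul_sum,
        map_sum, LinearEquiv.coe_coe, TensorProduct.tensorTensorTensorComm_tmul,
        LinearMap.lTensor_tmul, LinearMap.mul'_apply, Fintype.sum_prod_type,
        Basis.tensorProduct_apply]
      exact Finset.sum_comm
    conv_lhs => rw [eq_sum_sum_smul_tmul b x]
    simp only [map_sum, map_smul, h0, Finset.smul_sum]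
    simp only [← TensorProduct.tmul_smul]
    refine ((Finset.sum_congr rfl fun i _ => Finset.sum_comm).trans Finset.sum_comm).trans ?_
    refine Finset.sum_congr rfl fun q _ => ?_
    simp only [← TensorProduct.tmul_sum]
    rw [sum_sum_smul_mul_eq]
  have h2 : x ⊗ₜ[k] (1 : H) = ∑ q : ι × ι, b.tensorProduct b q ⊗ₜ[k]
      tensorMatrix b H x q.1 q.2 := by
    conv_lhs => rw [← (b.tensorProduct b).sum_repr x]
    rw [TensorProduct.sum_tmul]
    refine Finset.sum_congr rfl fun q _ => ?_
    rw [TensorProduct.smul_tmul, ← Algebra.algebraMap_eq_smul_one]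
    rfl
  rw [IsCoinvariant, h1, h2, sum_basis_tmul_inj]
  exact ⟨fun h => Matrix.ext fun i j => congr_fun h (i, j), fun h => by rw [h]⟩

lemma isCyclic_iff (x : K ⊗[k] K) : ρ.IsCyclic x ↔
    ρ.matrix b * tensorMatrix b H x =
      tensorMatrix b H x * ((ρ.matrix b).map (antipode k))ᵀ := by
  refine assoc_rTensor_eq_lTensor_iff b _ _ _ (fun j => ?_) x
  simp [coact_basis ρ b]

/-- Coinvariance and the cyclic condition are equivalent if `S² = 1`, and both hold for a symmetric
separability idempotent. -/
theorem isCoinvariant_and_isCyclic (hS : ∀ x : H, antipode k (antipode k x) = x) {p : K ⊗[k] K}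
    (hp : IsSymmSepIdempotent k p) :
    ρ.IsCoinvariant p ∧ ρ.IsCyclic p ∧ ∀ x, ρ.IsCoinvariant x ↔ ρ.IsCyclic x := by
  classical
  have := hp.exists_trace.1
  let b := finBasis k K
  have h1 := mul_antipode_matrix (ρ.counit_matrix b) (ρ.comul_matrix b)
  have h2 := antipode_matrix_mul (ρ.counit_matrix b) (ρ.comul_matrix b)
  have h3 := transpose_mul_antipode_transpose hS h1
  have h4 := antipode_transpose_mul_transpose hS h2
  have hiff (x : K ⊗[k] K) : ρ.IsCoinvariant x ↔ ρ.IsCyclic x := by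
    rw [ρ.isCoinvariant_iff b, ρ.isCyclic_iff b, mul_mul_transpose_eq_iff h3 h4]
  have hco : ρ.IsCoinvariant p :=
    (ρ.isCoinvariant_iff b p).2 (hp.coactMatrix_mul_tensorMatrix b ρ.coact h1 h3 h4)
  exact ⟨hco, (hiff p).1 hco, hiff⟩

end RightComoduleAlgebra

namespace LeftComoduleAlgebra

open HopfAlgebra Coalgebra

variable {k H K ι : Type*} [Field k] [Ring H] [HopfAlgebra k H] [Ring K] [Algebra k K]
  (ρ : LeftComoduleAlgebra k H K) [Fintype ι] (b : Basis ι k K)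

/-- The coaction with its tensor factors exchanged. -/
def flipCoact : K →ₐ[k] K ⊗[k] H :=
  (Algebra.TensorProduct.comm k H K).toAlgHom.comp ρ.coact

/-- The coefficient matrix of the coaction. -/
abbrev matrix : Matrix ι ι H := coactMatrix b ρ.flipCoact.toLinearMap

lemma coact_basis (j : ι) : ρ.coact (b j) = ∑ i, ρ.matrix b i j ⊗ₜ[k] b i := by
  have h : Algebra.TensorProduct.comm k H K (ρ.coact (b j)) = ∑ i, b i ⊗ₜ[k] ρ.matrix b i j :=
    apply_basis_eq_sum b ρ.flipCoact.toLinearMap j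
  apply (Algebra.TensorProduct.comm k H K).injective
  rw [h, map_sum]
  simp

lemma comul_matrix (i j : ι) :
    comul (R := k) ((ρ.matrix b)ᵀ i j) = ∑ l, (ρ.matrix b)ᵀ i l ⊗ₜ[k] (ρ.matrix b)ᵀ l j := by
  have h := congr($(ρ.coassoc) (b i))
  simp only [LinearMap.comp_apply, AlgHom.toLinearMap_apply, coact_basis ρ b, map_sum,
    LinearMap.rTensor_tmul, LinearMap.lTensor_tmul, TensorProduct.tmul_sum, LinearEquiv.coe_coe]
    at h
  have h' := congr((TensorProduct.assoc k H H K).symm $h)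
  simp only [map_sum, TensorProduct.assoc_symm_tmul, LinearEquiv.symm_apply_apply] at h'
  rw [Finset.sum_comm] at h'
  simp only [← TensorProduct.sum_tmul] at h'
  exact congr_fun ((sum_tmul_basis_inj b).1 h'.symm) j

lemma counit_matrix [DecidableEq ι] (i j : ι) :
    counit (R := k) ((ρ.matrix b)ᵀ i j) = if i = j then 1 else 0 := by
  have h := congr(b.repr ($(ρ.counit_coact) (b i)) j)
  simp only [LinearMap.comp_apply, AlgHom.toLinearMap_apply, coact_basis ρ b, map_sum,
    LinearMap.rTensor_tmul, LinearEquiv.coe_coe, TensorProduct.lid_tmul, map_smul,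
    Basis.repr_self, LinearMap.id_apply, Finsupp.coe_finsetSum, Finset.sum_apply,
    Finsupp.smul_apply, Finsupp.single_apply, smul_eq_mul, mul_ite, mul_one, mul_zero,
    Finset.sum_ite_eq', Finset.mem_univ, if_true] at h
  exact h

lemma isCoinvariant_iff (x : K ⊗[k] K) : ρ.IsCoinvariant x ↔
    ρ.matrix b * tensorMatrix b H x * (ρ.matrix b)ᵀ = tensorMatrix b H x := by
  have h1 : ρ.envCoact x = ∑ q : ι × ι,
      (ρ.matrix b * tensorMatrix b H x * (ρ.matrix b)ᵀ) q.1 q.2 ⊗ₜ[k] b.tensorProduct b q := by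
    have h0 (i j) : ρ.envCoact (b i ⊗ₜ[k] b j) = ∑ q : ι × ι,
        (ρ.matrix b q.1 i * ρ.matrix b q.2 j) ⊗ₜ[k] b.tensorProduct b q := by
      simp only [envCoact, LinearMap.comp_apply, TensorProduct.map_tmul,
        AlgHom.toLinearMap_apply, coact_basis ρ b, TensorProduct.sum_tmul, TensorProduct.tmul_sum,
        map_sum, LinearEquiv.coe_coe, TensorProduct.tensorTensorTensorComm_tmul,
        LinearMap.rTensor_tmul, LinearMap.mul'_apply, Fintype.sum_prod_type,
        Basis.tensorProduct_apply]
      exact Finset.sum_comm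
    conv_lhs => rw [eq_sum_sum_smul_tmul b x]
    simp only [map_sum, map_smul, h0, Finset.smul_sum]
    simp only [TensorProduct.smul_tmul']
    refine ((Finset.sum_congr rfl fun i _ => Finset.sum_comm).trans Finset.sum_comm).trans ?_
    refine Finset.sum_congr rfl fun q _ => ?_
    simp only [← TensorProduct.sum_tmul]
    rw [sum_sum_smul_mul_eq]
  have h2 : (1 : H) ⊗ₜ[k] x = ∑ q : ι × ι,
      tensorMatrix b H x q.1 q.2 ⊗ₜ[k] b.tensorProduct b q := by
    conv_lhs => rw [← (b.tensorProduct b).sum_repr x]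
    rw [TensorProduct.tmul_sum]
    refine Finset.sum_congr rfl fun q _ => ?_
    rw [← TensorProduct.smul_tmul, ← Algebra.algebraMap_eq_smul_one]
    rfl
  rw [IsCoinvariant, h1, h2, sum_tmul_basis_inj]
  exact ⟨fun h => Matrix.ext fun i j => congr_fun h (i, j), fun h => by rw [h]⟩

lemma isCyclic_iff (x : K ⊗[k] K) : ρ.IsCyclic x ↔
    ρ.matrix b * tensorMatrix b H x =
      tensorMatrix b H x * ((ρ.matrix b).map (antipode k))ᵀ := by
  refine assoc_rTensor_eq_lTensor_iff b ρ.flipCoact.toLinearMap _ _ (fun j => ?_) x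
  simp [coact_basis ρ b]

/-- Coinvariance and the cyclic condition are equivalent if `S² = 1`, and both hold for a symmetric
separability idempotent. -/
theorem isCoinvariant_and_isCyclic (hS : ∀ x : H, antipode k (antipode k x) = x) {p : K ⊗[k] K}
    (hp : IsSymmSepIdempotent k p) :
    ρ.IsCoinvariant p ∧ ρ.IsCyclic p ∧ ∀ x, ρ.IsCoinvariant x ↔ ρ.IsCyclic x := by
  classical
  have := hp.exists_trace.1
  let b := finBasis k K
  -- For a left coaction the transpose of R is the comultiplicative matrix, so the antipode axioms
  -- give the transposed identities directly; S² = 1 enters only through `h1`.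
  have h3 : (ρ.matrix b)ᵀ * ((ρ.matrix b).map (antipode k))ᵀ = 1 :=
    mul_antipode_matrix (ρ.counit_matrix b) (ρ.comul_matrix b)
  have h4 : ((ρ.matrix b).map (antipode k))ᵀ * (ρ.matrix b)ᵀ = 1 :=
    antipode_matrix_mul (ρ.counit_matrix b) (ρ.comul_matrix b)
  have h1 : ρ.matrix b * (ρ.matrix b).map (antipode k) = 1 :=
    transpose_mul_antipode_transpose hS h3
  have hiff (x : K ⊗[k] K) : ρ.IsCoinvariant x ↔ ρ.IsCyclic x := by
    rw [ρ.isCoinvariant_iff b, ρ.isCyclic_iff b, mul_mul_transpose_eq_iff h3 h4]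
  have hco : ρ.IsCoinvariant p :=
    (ρ.isCoinvariant_iff b p).2 (hp.coactMatrix_mul_tensorMatrix b ρ.flipCoact h1 h3 h4)
  exact ⟨hco, (hiff p).1 hco, hiff⟩

end LeftComoduleAlgebra

end

theorem mainTheorem3 {k : Type*} [Field k] [IsAlgClosed k] [CharZero k]
    {H : Type*} [Ring H] [HopfAlgebra k H] [IsSemisimpleRing H]
    {K : Type*} [Ring K] [Algebra k K] [IsSemisimpleRing K]
    (p : K ⊗[k] K) (hp : IsSymmSepIdempotent k p) :
    (∀ ρ : RightComoduleAlgebra k H K,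
      ρ.IsCoinvariant p ∧ ρ.IsCyclic p ∧
        ∀ x : K ⊗[k] K, ρ.IsCoinvariant x ↔ ρ.IsCyclic x) ∧
    (∀ ρ : LeftComoduleAlgebra k H K,
      ρ.IsCoinvariant p ∧ ρ.IsCyclic p ∧
        ∀ x : K ⊗[k] K, ρ.IsCoinvariant x ↔ ρ.IsCyclic x) := by
  obtain ⟨Λ, hΛ⟩ := HopfAlgebra.exists_isNormalizedIntegral k H
  exact ⟨fun ρ => ρ.isCoinvariant_and_isCyclic hΛ.antipode_antipode hp,
    fun ρ => ρ.isCoinvariant_and_isCyclic hΛ.antipode_antipode hp⟩
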